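/- **Setting.** Let $X$ be a set and let ${\rm cost}:\mathbb R^d\times X\to\mathbb R_{\ge 0}$. For a finite set $B\subset\mathbb R^d$ with nonnegative weights $(w_b)_{b\in B}$ put ${\rm cost}(B,x)=\sum_{b\in B}w_b\,{\rm cost}(b,x)$; a finite set without specified weights has all weights $1$. For a finite set $A\subset\mathbb R^d$ and $a\in A$, the generalized sensitivity of $a$ with respect to the (weighted) finite set $B$ is $$s_a(A,B)=\sup_{x\in X,\ {\rm cost}(B,x)\ne 0}\frac{{\rm cost}(a,x)}{{\rm cost}(B,x)}\in[0,\infty]\qquad(\sup\emptyset=0).$$ For $\epsilon\in(0,1)$, a weighted set $B\subseteq A$ is an $\epsilon$-coreset of $A$ if $(1-\epsilon)\,{\rm cost}(A,x)\le{\rm cost}(B,x)\le(1+\epsilon)\,{\rm cost}(A,x)$ for all $x\in X$. For weights $w:A\to\mathbb R_{\ge0}$ the dimension $\dim(A,w,X,{\rm cost})$ is the least integer $D\ge 0$ such that for every $S\subseteq A$ with $|S|\ge 2$ there are at most $|S|^D$ different sets of the form $\{a\in S: w_a\,{\rm cost}(a,x)\le r\}$, $x\in X$, $r\in[0,\infty)$.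 **Theorem.** There is a universal constant $c>0$ with the following property. Let $d\geq 0$, let $X$ be a set, let ${\rm cost}:\mathbb R^d\times X\to\mathbb R_{\ge0}$, and suppose that there is a finite number ${\rm sum}(s)$ such that $\sum_{a\in C}s_a(C,C)\le{\rm sum}(s)$ for every finite $C\subset\mathbb R^d$. Then for every finite set $A\subset\mathbb R^d$, with $n=|A|$: 1. (Consistent total weights) $\sum_{a\in S}s_a(S,S)\le{\rm sum}(s)$ for every $S\subseteq A$. 2. (Uniform sampling bound) For every $A'\subseteq A$, in particular for every outcome of a uniform sampling of a subset of $A$, put $s'_a(A,A')=s_a(A,A')$ if $a\in A'$ and $s'_a(A,A')=s_a(A,A'\cup\{a\})$ if $a\in A\setminus A'$. Then $s'_a(A,A')\ge s_a(A,A)$ for all $a\in A$. 3. (Importance sampling bound) Let $u_a\in[0,\infty)$ with $u_a\ge s_a(A,A)$ for all $a\in A$, put $\|u\|_1=\sum_{a\in A}u_a$, and let $\epsilon,\delta\in(0,1)$. Let $\gamma\ge 0$, put $q_a=\min\{1,\gamma u_a\}$ and $D=\dim(A,1/q,X,{\rm cost})$ (with $1/0:=0$), and assume $$\gamma\ \ge\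 c\,\epsilon^{-2}\bigl(D\,\log(2+D\min\{n,\|u\|_1\})+\log(2/\delta)\bigr).$$ Let $B$ be the random subset of $A$ that contains each $a\in A$ independently with probability $q_a$, with weights $1/q_a$. Then the expected size of $B$ is at most $\gamma\|u\|_1$, and with probability at least $1-\delta$ the weighted set $B$ is an $\epsilon$-coreset of $A$ and $|B|\le 2\gamma\max\{1,\|u\|_1\}$. 4. (Coresets preserve weights) If $\epsilon\in(0,1)$ and the weighted set $B$ is an $\epsilon$-coreset of $A$, then for every finite $C\subset\mathbb R^d$ and every $c_0\in C$ $$\frac1{1+\epsilon}\,s_{c_0}(C,A)\ \le\ s_{c_0}(C,B)\ \le\ \frac1{1-\epsilon}\,s_{c_0}(C,A).$$ -/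

import Mathlib

open scoped NNReal ENNReal

noncomputable section

/-- A finite set of points together with nonnegative weights on its points
(the values of `wt` off `pts` are irrelevant). -/
structure WeightedSet (E : Type*) where
  pts : Finset E
  wt : E → ℝ≥0

/-- An unweighted finite set, all weights being `1`. -/
def WeightedSet.ofFinset {E : Type*} (A : Finset E) : WeightedSet E := ⟨A, fun _ => 1⟩

/-- The cost `∑ b ∈ B, w_b * cost (b, x)` of a weighted set. -/
def WeightedSet.cost {E X : Type*} (cost : E → X → ℝ≥0) (B : WeightedSet E) (x : X) : ℝ≥0 :=
  ∑ b ∈ B.pts, B.wt b * cost b x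

/-- `B`, with its weights, is an `ε`-coreset of `A`. -/
def IsCoreset {E X : Type*} (cost : E → X → ℝ≥0) (ε : ℝ) (B : WeightedSet E) (A : Finset E) :
    Prop :=
  B.pts ⊆ A ∧ ∀ x : X,
    (1 - ε) * ((WeightedSet.ofFinset A).cost cost x : ℝ) ≤ (B.cost cost x : ℝ) ∧
    (B.cost cost x : ℝ) ≤ (1 + ε) * ((WeightedSet.ofFinset A).cost cost x : ℝ)

/-- The generalized sensitivity `s_a(A, B)` of `a ∈ A` with respect to a weighted set `B`:
the supremum of `cost (a, x) / cost (B, x)` over the `x` with `cost (B, x) ≠ 0`. It is taken in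
`[0, ∞]` because it may be infinite when `a` is not in `B`. It depends on `A` through `a` only. -/
def sensitivity {E X : Type*} (cost : E → X → ℝ≥0) (_A : Finset E) (B : WeightedSet E) (a : E) :
    ℝ≥0∞ :=
  ⨆ (x : X) (_ : B.cost cost x ≠ 0), ((cost a x / B.cost cost x : ℝ≥0) : ℝ≥0∞)

open Classical in
/-- The traces on `S` of the ranges `{a | w_a * cost (a, x) ≤ r}`, for `x : X` and `r ≥ 0`. -/
def rangeTraces {E X : Type*} (cost : E → X → ℝ≥0) (w : E → ℝ≥0) (S : Finset E) :
    Set (Finset E) :=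
  {R | ∃ (x : X) (r : ℝ≥0), R = S.filter (fun a => w a * cost a x ≤ r)}

/-- The dimension of the system `(A, w, X, cost)`: the least `D` such that every `S ⊆ A` with at
least two points has at most `|S| ^ D` traces of ranges. -/
def systemDim {E X : Type*} (cost : E → X → ℝ≥0) (A : Finset E) (w : E → ℝ≥0) : ℕ :=
  sInf {D : ℕ | ∀ S ⊆ A, 2 ≤ S.card → (rangeTraces cost w S).ncard ≤ S.card ^ D}

open Classical in
/-- The probability that independent sampling, which keeps each `a ∈ A` with probability `q a`,
returns exactly the subset `B` of `A`. -/
def sampleMass {E : Type*} (A : Finset E) (q : E → ℝ≥0) (B : Finset E) : ℝ :=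
  (∏ a ∈ B, (q a : ℝ)) * ∏ a ∈ A \ B, (1 - (q a : ℝ))

open Classical in
/-- The probability that the random subset of `A` has the property `P`. -/
def sampleProb {E : Type*} (A : Finset E) (q : E → ℝ≥0) (P : Finset E → Prop) : ℝ :=
  ∑ B ∈ A.powerset.filter P, sampleMass A q B

/-- The expected number of points of the random subset of `A`. -/
def expectedSize {E : Type*} (A : Finset E) (q : E → ℝ≥0) : ℝ :=
  ∑ B ∈ A.powerset, sampleMass A q B * (B.card : ℝ)

/-- The sampling probabilities `min {1, γ * u_a}`. -/
def samplingRate {E : Type*} (γ : ℝ≥0) (u : E → ℝ≥0) (a : E) : ℝ≥0 := min 1 (γ * u a)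

open Classical in
/-- The modified weights `w'_a(A, A')`: with respect to `A'` if `a ∈ A'`, and with respect to
`A' ∪ {a}` otherwise. -/
def uniformOverestimate {E : Type*} (W : Finset E → WeightedSet E → E → ℝ≥0∞)
    (A A' : Finset E) (a : E) : ℝ≥0∞ :=
  if a ∈ A' then W A (WeightedSet.ofFinset A') a else W A (WeightedSet.ofFinset (insert a A')) a

/-- The four conditions on a weight function `W`, where `W A B a` is the weight of `a ∈ A` with
respect to the (weighted) set `B`. The total weight bound is `sumW`, and `g` is the oversampling
factor, as a function of the accuracy `ε`, the failure probability `δ`, the number of points, the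
total overestimate `∑ u_a`, and the dimension of the system whose weights are the weights `1 / q_a`
of the sample. -/
structure SamplingConditions {E X : Type*} (cost : E → X → ℝ≥0)
    (W : Finset E → WeightedSet E → E → ℝ≥0∞) (sumW : ℝ≥0)
    (g : ℝ → ℝ → ℕ → ℝ → ℕ → ℝ) : Prop where
  /-- Consistent total weights. -/
  consistent_total : ∀ A S : Finset E, S ⊆ A →
    ∑ a ∈ S, W S (WeightedSet.ofFinset S) a ≤ (sumW : ℝ≥0∞)
  /-- Uniform sampling bound; it holds for every outcome `A'` of the uniform sampling. -/
  uniform_sampling : ∀ A A' : Finset E, A' ⊆ A → ∀ a ∈ A,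
    W A (WeightedSet.ofFinset A) a ≤ uniformOverestimate W A A' a
  /-- Importance sampling bound. -/
  importance_sampling : ∀ (A : Finset E) (u : E → ℝ≥0),
    (∀ a ∈ A, W A (WeightedSet.ofFinset A) a ≤ (u a : ℝ≥0∞)) →
    ∀ ε δ : ℝ, 0 < ε → ε < 1 → 0 < δ → δ < 1 → ∀ γ : ℝ≥0,
    g ε δ A.card (∑ a ∈ A, (u a : ℝ))
      (systemDim cost A (fun a => (samplingRate γ u a)⁻¹)) ≤ (γ : ℝ) →
    expectedSize A (samplingRate γ u) ≤ (γ : ℝ) * ∑ a ∈ A, (u a : ℝ) ∧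
    1 - δ ≤ sampleProb A (samplingRate γ u) (fun B =>
      IsCoreset cost ε ⟨B, fun a => (samplingRate γ u a)⁻¹⟩ A ∧
      (B.card : ℝ) ≤ 2 * (γ : ℝ) * max 1 (∑ a ∈ A, (u a : ℝ)))
  /-- Coresets preserve weights. -/
  coreset_preserves : ∀ ε : ℝ, 0 < ε → ε < 1 → ∀ (A : Finset E) (B : WeightedSet E),
    IsCoreset cost ε B A → ∀ (C : Finset E), ∀ c ∈ C,
    ENNReal.ofReal (1 / (1 + ε)) * W C (WeightedSet.ofFinset A) c ≤ W C B c ∧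
    W C B c ≤ ENNReal.ofReal (1 / (1 - ε)) * W C (WeightedSet.ofFinset A) c

/-- The oversampling factor
`c * ε⁻² * (dim * log (2 + dim * min {n, U}) + log (2 / δ))`. -/
def oversampling (c ε δ : ℝ) (n : ℕ) (U : ℝ) (dim : ℕ) : ℝ :=
  c / ε ^ 2 * ((dim : ℝ) * Real.log (2 + (dim : ℝ) * min (n : ℝ) U) + Real.log (2 / δ))

end

/-! The consistent total, uniform sampling and coreset conditions follow by comparing ratios. The
substance is the importance sampling bound.

Fix `x` and put `f a = cost a x / cost (A, x)`, so `f a ≤ u a`, and `g a = f a / q a`. If `q a < 1`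
then `g a ≤ 1 / γ`; if `q a = 1` the point is always sampled and contributes no error. Hence the
relative error of the sample is the integral over `t ∈ [0, 1 / γ)` of the deviation of `|B ∩ {g >
t}|` from its mean. It is at most `ε` as soon as every superlevel set `R` has deviation at most `ε /
2 * (q(R) + γ)`, where `q(R)` is the expected size of `B ∩ R` (`isCoreset_of_deviation_le`).

This uniform relative deviation bound (`sampleProb_exists_deviation_gt_le`) comes from
symmetrization: comparison with an independent second sample `B'` and random exchanges between the
two reduce it to random signs on `S = B ∆ B'`, where `|S| ≤ 4 * m` and `m` bounds the expected
sample size. There `sampleProb_exists_signSum_gt_le` chains over nets of the traces at scales `γ / 2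
^ k`, whose sizes are controlled by a Haussler-type packing bound (`card_le_of_isSeparatedFamily`).
Since the coarsest scale is already `γ`, only the ratio `m / γ = ∑ min (1, u a)` enters the
logarithm. A union bound over all traces on `S` would leave an additional `log γ`. -/

open Classical in
/-- The expectation of `F` at the random subset of `A`. -/
noncomputable def sampleExp {E : Type*} (A : Finset E) (q : E → ℝ≥0) (F : Finset E → ℝ) : ℝ :=
  ∑ B ∈ A.powerset, sampleMass A q B * F B

/-! ### Independent sampling: expectations, union bounds and Chernoff bounds. -/

section Sampling

variable {E : Type*} {A : Finset E} {q : E → ℝ≥0}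

lemma sampleMass_nonneg (hq : ∀ a ∈ A, q a ≤ 1) (B : Finset E) :
    0 ≤ sampleMass A q B := by
  classical
  unfold sampleMass
  refine mul_nonneg (Finset.prod_nonneg fun a _ => (q a).2) (Finset.prod_nonneg fun a ha => ?_)
  have := hq a (Finset.mem_sdiff.1 (by convert ha)).1
  have h : (q a : ℝ) ≤ 1 := by exact_mod_cast this
  linarith

-- Independence of the points, in product form: expanding the product on the right gives one term
-- for each outcome `B`.
open Classical in
lemma sampleExp_prod (A : Finset E) (q : E → ℝ≥0) (f g : E → ℝ) :
    sampleExp A q (fun B => ∏ a ∈ A, if a ∈ B then f a else g a) =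
      ∏ a ∈ A, ((q a : ℝ) * f a + (1 - q a) * g a) := by
  rw [Finset.prod_add]
  unfold sampleExp
  refine Finset.sum_congr rfl fun B hB => ?_
  have hBA := Finset.mem_powerset.1 hB
  beta_reduce
  rw [← Finset.prod_sdiff hBA (f := fun a => if a ∈ B then f a else g a)]
  rw [Finset.prod_congr rfl (g := g) (s₁ := A \ B) fun a ha => by
    simp [(Finset.mem_sdiff.1 ha).2]]
  rw [Finset.prod_congr rfl (g := f) (s₁ := B) fun a ha => by simp [ha]]
  rw [Finset.prod_mul_distrib, Finset.prod_mul_distrib]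
  unfold sampleMass
  ring

lemma sampleExp_mono (hq : ∀ a ∈ A, q a ≤ 1) {F G : Finset E → ℝ}
    (h : ∀ B ⊆ A, sampleMass A q B ≠ 0 → F B ≤ G B) : sampleExp A q F ≤ sampleExp A q G := by
  refine Finset.sum_le_sum fun B hB => ?_
  have hB := Finset.mem_powerset.1 hB
  by_cases h0 : sampleMass A q B = 0
  · simp [h0]
  · exact mul_le_mul_of_nonneg_left (h B hB h0) (sampleMass_nonneg hq B)

lemma sampleExp_add (F G : Finset E → ℝ) :
    sampleExp A q (fun B => F B + G B) = sampleExp A q F + sampleExp A q G := by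
  simp [sampleExp, mul_add, Finset.sum_add_distrib]

lemma sampleExp_sum {ι : Type*} (s : Finset ι) (F : ι → Finset E → ℝ) :
    sampleExp A q (fun B => ∑ i ∈ s, F i B) = ∑ i ∈ s, sampleExp A q (F i) := by
  simp only [sampleExp, Finset.mul_sum]
  exact Finset.sum_comm

lemma sampleExp_const_mul (c : ℝ) (F : Finset E → ℝ) :
    sampleExp A q (fun B => c * F B) = c * sampleExp A q F := by
  simp only [sampleExp, Finset.mul_sum]
  exact Finset.sum_congr rfl fun B _ => by ring

lemma sampleExp_const (A : Finset E) (q : E → ℝ≥0) (c : ℝ) : sampleExp A q (fun _ => c) = c := by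
  classical
  have := sampleExp_prod A q (fun _ => 1) (fun _ => 1)
  have h1 : sampleExp A q (fun _ => 1) = 1 := by simpa using this
  have := sampleExp_const_mul (A := A) (q := q) c (fun _ => 1)
  simpa [h1] using this

open Classical in
lemma sampleProb_eq_sampleExp (A : Finset E) (q : E → ℝ≥0) (P : Finset E → Prop) :
    sampleProb A q P = sampleExp A q (fun B => if P B then 1 else 0) := by
  simp [sampleProb, sampleExp, Finset.sum_filter]

lemma sampleProb_nonneg (hq : ∀ a ∈ A, q a ≤ 1) (P : Finset E → Prop) : 0 ≤ sampleProb A q P :=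
  Finset.sum_nonneg fun _ _ => sampleMass_nonneg hq _

lemma sampleProb_mono (hq : ∀ a ∈ A, q a ≤ 1) {P Q : Finset E → Prop}
    (h : ∀ B ⊆ A, sampleMass A q B ≠ 0 → P B → Q B) : sampleProb A q P ≤ sampleProb A q Q := by
  classical
  rw [sampleProb_eq_sampleExp, sampleProb_eq_sampleExp]
  refine sampleExp_mono hq fun B hB h0 => ?_
  by_cases hP : P B
  · simp [hP, h B hB h0 hP]
  · simp only [hP, if_false]; split_ifs <;> norm_num

lemma sampleProb_or_le (hq : ∀ a ∈ A, q a ≤ 1) (P Q : Finset E → Prop) :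
    sampleProb A q (fun B => P B ∨ Q B) ≤ sampleProb A q P + sampleProb A q Q := by
  classical
  simp only [sampleProb_eq_sampleExp]
  rw [← sampleExp_add]
  refine sampleExp_mono hq fun B _ _ => ?_
  by_cases hP : P B <;> by_cases hQ : Q B <;> simp [hP, hQ]

lemma sampleProb_exists_le (hq : ∀ a ∈ A, q a ≤ 1) {ι : Type*} (s : Finset ι)
    (P : ι → Finset E → Prop) :
    sampleProb A q (fun B => ∃ i ∈ s, P i B) ≤ ∑ i ∈ s, sampleProb A q (P i) := by
  classical
  simp only [sampleProb_eq_sampleExp]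
  rw [← sampleExp_sum]
  refine sampleExp_mono hq fun B _ _ => ?_
  by_cases h : ∃ i ∈ s, P i B
  · obtain ⟨i, hi, hP⟩ := h
    rw [if_pos ⟨i, hi, hP⟩]
    have := Finset.single_le_sum (f := fun i => if P i B then (1 : ℝ) else 0)
      (fun j _ => by split_ifs <;> norm_num) hi
    simpa [hP] using this
  · rw [if_neg h]
    exact Finset.sum_nonneg fun j _ => by split_ifs <;> norm_num

lemma sampleProb_add_not (A : Finset E) (q : E → ℝ≥0) (P : Finset E → Prop) :
    sampleProb A q P + sampleProb A q (fun B => ¬ P B) = 1 := by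
  classical
  simp only [sampleProb_eq_sampleExp]
  rw [← sampleExp_add]
  refine Eq.trans ?_ (sampleExp_const A q 1)
  congr 1; ext B
  by_cases hP : P B <;> simp [hP]

lemma sampleProb_lt_le_exp (hq : ∀ a ∈ A, q a ≤ 1) (X : Finset E → ℝ) (t : ℝ) :
    sampleProb A q (fun B => t < X B) ≤ Real.exp (-t) * sampleExp A q (fun B => Real.exp (X B)) := by
  classical
  rw [sampleProb_eq_sampleExp, ← sampleExp_const_mul]
  refine sampleExp_mono hq fun B _ _ => ?_
  rw [← Real.exp_add]
  split_ifs with h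
  · exact Real.one_le_exp (by linarith)
  · positivity

open Classical in
/-- The deviation of `|B ∩ R|` from its mean. -/
noncomputable def deviation (q : E → ℝ≥0) (R B : Finset E) : ℝ :=
  ∑ a ∈ R, ((if a ∈ B then 1 else 0) - (q a : ℝ))

/-- The variance proxy is the mean `∑ q a` and not `|R|`, which is what makes the later bounds
relative. Each factor is `e^(-l q) * (1 + q * (e^l - 1))`, and `e^l - 1 ≤ l + l ^ 2` for `|l| ≤ 1`.
-/
lemma sampleExp_exp_deviation_le (hq : ∀ a ∈ A, q a ≤ 1) {R : Finset E} (hR : R ⊆ A) {l : ℝ}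
    (hl : |l| ≤ 1) :
    sampleExp A q (fun B => Real.exp (l * deviation q R B)) ≤
      Real.exp (l ^ 2 * ∑ a ∈ R, (q a : ℝ)) := by
  classical
  have key : ∀ B, Real.exp (l * deviation q R B) = ∏ a ∈ A, if a ∈ B then
      (if a ∈ R then Real.exp (l * (1 - q a)) else 1) else
      (if a ∈ R then Real.exp (l * (0 - q a)) else 1) := by
    intro B
    rw [deviation, Finset.mul_sum, Real.exp_sum, ← Finset.prod_subset hR
      (f := fun a => if a ∈ B then _ else _) (by intro a _ h; simp [h])]
    refine Finset.prod_congr rfl fun a ha => ?_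
    simp only [ha, if_true]
    split_ifs <;> rfl
  simp only [key]
  rw [sampleExp_prod]
  have h2 : Real.exp (l ^ 2 * ∑ a ∈ R, (q a : ℝ)) =
      ∏ a ∈ A, if a ∈ R then Real.exp (l ^ 2 * q a) else 1 := by
    rw [Finset.mul_sum, Real.exp_sum, Finset.prod_ite_mem, Finset.inter_eq_right.2 hR]
  rw [h2]
  refine Finset.prod_le_prod (fun a ha => ?_) fun a ha => ?_
  · have h : (q a : ℝ) ≤ 1 := by exact_mod_cast hq a ha
    have h' : (0 : ℝ) ≤ 1 - q a := by linarith
    split_ifs <;> positivity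
  · split_ifs with h
    · have e1 : Real.exp (l * (1 - q a)) = Real.exp (-(l * q a)) * Real.exp l := by
        rw [← Real.exp_add]; congr 1; ring
      have e2 : Real.exp (l * (0 - q a)) = Real.exp (-(l * q a)) := by congr 1; ring
      rw [e1, e2]
      have e3 : Real.exp (l ^ 2 * q a) =
          Real.exp (-(l * q a)) * Real.exp (q a * (l + l ^ 2)) := by
        rw [← Real.exp_add]; congr 1; ring
      rw [e3]
      have h1 : Real.exp l - 1 - l ≤ l ^ 2 :=
        (le_abs_self _).trans (Real.abs_exp_sub_one_sub_id_le hl)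
      have h3 := Real.add_one_le_exp ((q a : ℝ) * (l + l ^ 2))
      have h4 : (q a : ℝ) * (Real.exp l - 1) ≤ q a * (l + l ^ 2) :=
        mul_le_mul_of_nonneg_left (by linarith) (q a).2
      have h5 := mul_le_mul_of_nonneg_left (show (q a : ℝ) * Real.exp l + (1 - q a) ≤
        Real.exp (q a * (l + l ^ 2)) by linarith) (Real.exp_pos (-(l * q a))).le
      linarith
    · simp

lemma sampleProb_deviation_gt_le (hq : ∀ a ∈ A, q a ≤ 1) {R : Finset E} (hR : R ⊆ A) {l : ℝ}
    (hl : |l| ≤ 1) (t : ℝ) :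
    sampleProb A q (fun B => t < l * deviation q R B) ≤
      Real.exp (l ^ 2 * ∑ a ∈ R, (q a : ℝ) - t) := by
  refine (sampleProb_lt_le_exp hq _ t).trans ?_
  rw [sub_eq_neg_add, Real.exp_add]
  exact mul_le_mul_of_nonneg_left (sampleExp_exp_deviation_le hq hR hl) (Real.exp_pos _).le

lemma sampleProb_abs_deviation_gt_le (hq : ∀ a ∈ A, q a ≤ 1) {R : Finset E} (hR : R ⊆ A) {l : ℝ}
    (hl0 : 0 < l) (hl : l ≤ 1) (t : ℝ) :
    sampleProb A q (fun B => t < |deviation q R B|) ≤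
      2 * Real.exp (l ^ 2 * ∑ a ∈ R, (q a : ℝ) - l * t) := by
  have h1 := sampleProb_deviation_gt_le hq hR (l := l) (by rwa [abs_of_pos hl0]) (l * t)
  have h2 := sampleProb_deviation_gt_le hq hR (l := -l) (by rwa [abs_neg, abs_of_pos hl0]) (l * t)
  rw [neg_sq] at h2
  have h3 := (sampleProb_mono hq (P := fun B => t < |deviation q R B|) fun B _ _ hB => ?_).trans
    (sampleProb_or_le hq (fun B => l * t < l * deviation q R B)
      (fun B => l * t < -l * deviation q R B))
  · linarith
  · rcases lt_abs.1 hB with h | h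
    · exact Or.inl (mul_lt_mul_of_pos_left h hl0)
    · right; nlinarith

lemma deviation_self {B : Finset E} (hB : B ⊆ A) :
    deviation q A B = (B.card : ℝ) - ∑ a ∈ A, (q a : ℝ) := by
  classical
  simp [deviation, Finset.sum_sub_distrib, Finset.inter_eq_right.2 hB]

lemma expectedSize_eq (A : Finset E) (q : E → ℝ≥0) : expectedSize A q = ∑ a ∈ A, (q a : ℝ) := by
  classical
  have h : expectedSize A q = sampleExp A q (fun B => ∑ a ∈ A, if a ∈ B then 1 else 0) := by
    refine Finset.sum_congr rfl fun B hB => ?_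
    simp [Finset.inter_eq_right.2 (Finset.mem_powerset.1 hB)]
  rw [h, sampleExp_sum]
  refine Finset.sum_congr rfl fun a ha => ?_
  -- The indicator of `a ∈ B` is written as a product over all points, with factor `0` only when `a`
  -- is missing.
  have := sampleExp_prod A q (fun _ => 1) (fun b => if b = a then 0 else 1)
  have h1 : (fun B : Finset E => ∏ b ∈ A, if b ∈ B then (1 : ℝ) else if b = a then 0 else 1) =
      fun B => if a ∈ B then 1 else 0 := by
    ext B
    split_ifs with hB
    · refine Finset.prod_eq_one fun b _ => ?_
      split_ifs with h1 h2 <;> simp_all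
    · exact Finset.prod_eq_zero ha (by simp [hB])
  rw [h1] at this
  rw [this, Finset.prod_eq_single_of_mem a ha]
  · simp
  · intro b _ hb; simp [hb]

/-- The random subset exceeds twice an upper bound of its mean with small probability. -/
lemma sampleProb_card_gt_le (hq : ∀ a ∈ A, q a ≤ 1) {m : ℝ} (hm : ∑ a ∈ A, (q a : ℝ) ≤ m) :
    sampleProb A q (fun B => 2 * m < (B.card : ℝ)) ≤ Real.exp (-(m / 4)) := by
  have h := sampleProb_deviation_gt_le hq subset_rfl (l := 1 / 2) (by norm_num [abs_of_pos]) (m / 2)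
  refine (sampleProb_mono hq fun B hB _ h => ?_).trans (h.trans (Real.exp_le_exp.2 (by linarith)))
  rw [deviation_self hB]
  linarith

end Sampling

/-! ### Packing bound for separated families with few traces. -/

section Packing

open scoped symmDiff

open Classical in
/-- Every subset of `S` with at least two points has at most `|T| ^ D` traces of members of `F`. -/
def HasTraceBound {E : Type*} (F : Finset (Finset E)) (S : Finset E) (D : ℕ) : Prop :=
  ∀ T ⊆ S, 2 ≤ T.card → (F.image (· ∩ T)).card ≤ T.card ^ D

open Classical in
/-- Two distinct members of `F` differ in more than `η` points. -/
def IsSeparatedFamily {E : Type*} (η : ℝ) (F : Finset (Finset E)) : Prop :=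
  ∀ R ∈ F, ∀ R' ∈ F, R ≠ R' → η < ((R ∆ R').card : ℝ)

variable {E : Type*}

-- A separated subfamily of maximal cardinality is a net: any set far from all its members could be
-- added to it.
open Classical in
lemma exists_separated_net (F : Finset (Finset E)) {η : ℝ} (hη : 0 ≤ η) :
    ∃ N ⊆ F, IsSeparatedFamily η N ∧ ∀ R ∈ F, ∃ R' ∈ N, ((R ∆ R').card : ℝ) ≤ η := by
  obtain ⟨N, hN, hmax⟩ := (F.powerset.filter (IsSeparatedFamily η)).exists_max_image Finset.card
    ⟨∅, by simp [IsSeparatedFamily]⟩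
  obtain ⟨hNF, hsep⟩ := Finset.mem_filter.1 hN
  rw [Finset.mem_powerset] at hNF
  refine ⟨N, hNF, hsep, fun R hR => ?_⟩
  by_contra! hcon
  have hRN : R ∉ N := fun h => by
    have := hcon R h
    simp at this
    linarith
  have := hmax (insert R N) (by
    refine Finset.mem_filter.2 ⟨Finset.mem_powerset.2 (Finset.insert_subset hR hNF), ?_⟩
    intro P hP Q hQ hPQ
    rcases Finset.mem_insert.1 hP with rfl | hP' <;>
      rcases Finset.mem_insert.1 hQ with rfl | hQ'
    · exact absurd rfl hPQ
    · exact hcon Q hQ'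
    · rw [symmDiff_comm]; exact hcon P hP'
    · exact hsep P hP' Q hQ' hPQ)
  rw [Finset.card_insert_of_notMem hRN] at this
  omega

open Classical in
lemma HasTraceBound.mono {F G : Finset (Finset E)} {S S' : Finset E} {D : ℕ}
    (h : HasTraceBound F S D) (hGF : G ⊆ F) (hS : S' ⊆ S) : HasTraceBound G S' D :=
  fun T hT h2 => (Finset.card_le_card (Finset.image_subset_image hGF)).trans
    (h T (hT.trans hS) h2)

-- `HasTraceBound` says nothing about sets with fewer than two points; the factor `2` covers their
-- at most two traces.
open Classical in
lemma HasTraceBound.card_image_le {F : Finset (Finset E)} {S : Finset E} {D : ℕ}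
    (h : HasTraceBound F S D) {T : Finset E} (hT : T ⊆ S) :
    (F.image (· ∩ T)).card ≤ 2 * (max 2 T.card) ^ D := by
  rcases le_or_gt 2 T.card with h2 | h2
  · rw [max_eq_right h2]
    have := h T hT h2
    omega
  · have h1 : (F.image (· ∩ T)).card ≤ 2 ^ T.card := by
      rw [← Finset.card_powerset]
      refine Finset.card_le_card fun R hR => ?_
      obtain ⟨Q, _, rfl⟩ := Finset.mem_image.1 hR
      simp
    have h3 : 2 ^ T.card ≤ 2 ^ 1 := Nat.pow_le_pow_right (by norm_num) (by omega)
    have h4 : 1 ≤ (max 2 T.card) ^ D := Nat.one_le_pow _ _ (by simp)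
    omega

-- Greedy choice of `T`. A pair not yet distinguished differs in more than `η` of the at most `m`
-- points of `S`, so by double counting some point splits at least a fraction `η / m` of the
-- remaining pairs.
open Classical in
lemma exists_small_distinguishing {N : Finset (Finset E)} {S : Finset E} {m η : ℝ}
    (hS : (S.card : ℝ) ≤ m) (hη : 0 < η) (hηm : η ≤ m) (hN : ∀ R ∈ N, R ⊆ S)
    (hsep : IsSeparatedFamily η N) (k : ℕ) :
    ∃ T ⊆ S, T.card ≤ k ∧
      ((((N ×ˢ N).filter fun p => p.1 ≠ p.2 ∧ p.1 ∩ T = p.2 ∩ T).card : ℝ)) ≤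
        (N.card : ℝ) ^ 2 * (1 - η / m) ^ k := by
  have hm : 0 < m := hη.trans_le hηm
  have h1 : 0 ≤ 1 - η / m := by rw [sub_nonneg, div_le_one hm]; exact hηm
  induction k with
  | zero =>
    refine ⟨∅, by simp, by simp, ?_⟩
    rw [pow_zero, mul_one, sq]
    exact_mod_cast (Finset.card_filter_le _ _).trans (Finset.card_product N N).le
  | succ k ih =>
    obtain ⟨T, hTS, hTk, hT⟩ := ih
    set P := (N ×ˢ N).filter fun p => p.1 ≠ p.2 ∧ p.1 ∩ T = p.2 ∩ T with hP
    rcases P.eq_empty_or_nonempty with h0 | hne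
    · refine ⟨T, hTS, by omega, ?_⟩
      rw [← hP, h0]
      simp only [Finset.card_empty, Nat.cast_zero]
      positivity
    have hdc : ∑ a ∈ S, ((P.filter fun p => a ∈ p.1 ∆ p.2).card : ℝ) =
        ∑ p ∈ P, ((p.1 ∆ p.2).card : ℝ) := by
      have := Finset.sum_card_bipartiteAbove_eq_sum_card_bipartiteBelow (s := S) (t := P)
        (fun a p => a ∈ p.1 ∆ p.2)
      have h2 : ∀ p ∈ P, Finset.bipartiteBelow (fun a (p : Finset E × Finset E) => a ∈ p.1 ∆ p.2) S p
          = p.1 ∆ p.2 := by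
        intro p hp
        have hpN := Finset.mem_product.1 (Finset.mem_filter.1 hp).1
        ext a
        simp only [Finset.mem_bipartiteBelow, and_iff_right_iff_imp, Finset.mem_symmDiff]
        rintro (h | h)
        · exact hN _ hpN.1 h.1
        · exact hN _ hpN.2 h.1
      rw [Finset.sum_congr (s₁ := P) rfl fun p hp => congrArg Finset.card (h2 p hp)] at this
      exact_mod_cast this
    have hlow : η * P.card ≤ ∑ p ∈ P, ((p.1 ∆ p.2).card : ℝ) := by
      rw [mul_comm, ← nsmul_eq_mul]
      refine Finset.card_nsmul_le_sum _ _ _ fun p hp => ?_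
      obtain ⟨hpN, hne, _⟩ := Finset.mem_filter.1 hp
      have := Finset.mem_product.1 hpN
      exact (hsep _ this.1 _ this.2 hne).le
    have hPpos : (0 : ℝ) < P.card := by exact_mod_cast hne.card_pos
    obtain ⟨a, ha, hacard⟩ : ∃ a ∈ S, η / m * P.card ≤
        ((P.filter fun p => a ∈ p.1 ∆ p.2).card : ℝ) := by
      by_contra! hcon
      have hSne : S.Nonempty := by
        by_contra h
        rw [Finset.not_nonempty_iff_eq_empty] at h
        rw [h, Finset.sum_empty] at hdc
        nlinarith
      have := Finset.sum_lt_sum_of_nonempty hSne hcon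
      rw [hdc, Finset.sum_const, nsmul_eq_mul] at this
      have h5 : (S.card : ℝ) * (η / m * P.card) ≤ m * (η / m * P.card) :=
        mul_le_mul_of_nonneg_right hS (by positivity)
      have h6 : m * (η / m * P.card) = η * P.card := by field_simp
      linarith
    refine ⟨insert a T, Finset.insert_subset ha hTS, (Finset.card_insert_le _ _).trans (by omega), ?_⟩
    have hsub : ((N ×ˢ N).filter fun p => p.1 ≠ p.2 ∧ p.1 ∩ insert a T = p.2 ∩ insert a T) ⊆
        P.filter fun p => ¬ a ∈ p.1 ∆ p.2 := by
      intro p hp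
      obtain ⟨hpN, hne, heq⟩ := Finset.mem_filter.1 hp
      have hmem : ∀ b ∈ insert a T, b ∈ p.1 ↔ b ∈ p.2 := by
        intro b hb
        have := Finset.ext_iff.1 heq b
        simpa only [Finset.mem_inter, hb, and_true] using this
      refine Finset.mem_filter.2 ⟨Finset.mem_filter.2 ⟨hpN, hne, ?_⟩, ?_⟩
      · ext b
        simp only [Finset.mem_inter, and_congr_left_iff]
        exact fun hb => hmem b (Finset.mem_insert_of_mem hb)
      · have := hmem a (Finset.mem_insert_self _ _)
        simp only [Finset.mem_symmDiff]
        tauto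
    have hc : ((P.filter fun p => a ∈ p.1 ∆ p.2).card : ℝ) +
        ((P.filter fun p => ¬ a ∈ p.1 ∆ p.2).card : ℝ) = P.card := by
      exact_mod_cast Finset.card_filter_add_card_filter_not (s := P) (fun p => a ∈ p.1 ∆ p.2)
    have h7 : ((((N ×ˢ N).filter fun p => p.1 ≠ p.2 ∧ p.1 ∩ insert a T = p.2 ∩ insert a T).card :
        ℝ)) ≤ ((P.filter fun p => ¬ a ∈ p.1 ∆ p.2).card : ℝ) := by
      exact_mod_cast Finset.card_le_card hsub
    rw [pow_succ (1 - η / m), ← mul_assoc]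
    have h8 := mul_le_mul_of_nonneg_right hT h1
    nlinarith

/-- Solves the implicit inequality for `l = log |N|` met in the packing bound. With `z = l / D`, the
tangent bound `log ((1 + z) / 2) ≤ (z - 1) / 2` costs only `l / 2`, which the left side absorbs. -/
lemma le_of_le_log_add {D : ℕ} {l x : ℝ} (hl : 0 ≤ l) (hx : 0 ≤ x)
    (h : l ≤ Real.log 2 + D * Real.log (2 * x * l + 2)) :
    l ≤ 2 + 5 * D * Real.log (2 + D * x) := by
  have hlog2 := Real.log_two_lt_d9
  have hlog2' := Real.log_two_gt_d9
  rcases Nat.eq_zero_or_pos D with rfl | hD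
  · simp at h ⊢; linarith
  have hD' : (0 : ℝ) < D := by exact_mod_cast hD
  set z := l / D with hz
  have hz0 : 0 ≤ z := by positivity
  have hl' : l = D * z := by rw [hz]; field_simp
  have h1 : Real.log (2 * x * l + 2) ≤ Real.log ((2 + D * x) ^ 2 * (2 * ((1 + z) / 2))) := by
    refine Real.log_le_log (by positivity) ?_
    rw [hl']
    have : 0 ≤ D * x := by positivity
    nlinarith [mul_nonneg this hz0, mul_nonneg (mul_nonneg this this) hz0]
  rw [Real.log_mul (by positivity) (by positivity), Real.log_mul (by norm_num) (by positivity),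
    Real.log_pow] at h1
  have h2 := Real.log_le_sub_one_of_pos (show 0 < (1 + z) / 2 by positivity)
  have h3 : Real.log 2 ≤ Real.log (2 + D * x) :=
    Real.log_le_log (by norm_num) (by linarith [show 0 ≤ D * x by positivity])
  have h4 : Real.log (2 * x * l + 2) ≤ 2 * Real.log (2 + D * x) + (z / 2 + 0.2) := by
    push_cast at h1
    linarith
  have h5 := mul_le_mul_of_nonneg_left h4 hD'.le
  have h6 : (D : ℝ) * 0.69 ≤ D * Real.log (2 + D * x) :=
    mul_le_mul_of_nonneg_left (by linarith) hD'.le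
  nlinarith

/-- A separated family with few traces is small. -/
lemma card_le_of_isSeparatedFamily {N : Finset (Finset E)} {S : Finset E} {D : ℕ} {m η : ℝ}
    (hS : (S.card : ℝ) ≤ m) (hη : 0 < η) (hN : ∀ R ∈ N, R ⊆ S)
    (hsep : IsSeparatedFamily η N) (htr : HasTraceBound N S D) :
    (N.card : ℝ) ≤ Real.exp (2 + 5 * D * Real.log (2 + D * (m / η))) := by
  classical
  have hm0 : 0 ≤ m := le_trans (by positivity) hS
  have hx : 0 ≤ m / η := by positivity
  have hlogpos : 0 ≤ Real.log (2 + D * (m / η)) :=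
    Real.log_nonneg (by linarith [show 0 ≤ D * (m / η) by positivity])
  rcases le_or_gt N.card 1 with h1 | h1
  · calc (N.card : ℝ) ≤ 1 := by exact_mod_cast h1
      _ ≤ _ := Real.one_le_exp (by positivity)
  obtain ⟨R, hR, R', hR', hne⟩ := Finset.one_lt_card.1 h1
  have hηm : η ≤ m := by
    refine (hsep R hR R' hR' hne).le.trans (le_trans ?_ hS)
    have : R ∆ R' ⊆ S := by
      intro a ha
      rcases Finset.mem_symmDiff.1 ha with h | h
      exacts [hN R hR h.1, hN R' hR' h.1]
    exact_mod_cast Finset.card_le_card this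
  have hm : 0 < m := hη.trans_le hηm
  have hNpos : (0 : ℝ) < N.card := by exact_mod_cast (by omega : 0 < N.card)
  set l := Real.log N.card with hl
  have hl0 : 0 ≤ l := Real.log_nonneg (by exact_mod_cast h1.le)
  set x := m / η with hxdef
  have hx0 : 0 < x := by positivity
  -- `k > 2 * x * l` makes `|N| ^ 2 * (1 - η / m) ^ k < 1`, so no pair is left undistinguished and
  -- `N` is no larger than its set of traces on `T`.
  set k := ⌊2 * x * l⌋₊ + 1 with hk
  have hk1 : 2 * x * l < k := by rw [hk]; push_cast; exact Nat.lt_floor_add_one _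
  have hk2 : (k : ℝ) ≤ 2 * x * l + 1 := by
    rw [hk]; push_cast; linarith [Nat.floor_le (show 0 ≤ 2 * x * l by positivity)]
  obtain ⟨T, hTS, hTk, hT⟩ := exists_small_distinguishing hS hη hηm hN hsep k
  have hsmall : (N.card : ℝ) ^ 2 * (1 - η / m) ^ k < 1 := by
    have e1 : (1 - η / m) ^ k ≤ Real.exp (-(k / x)) := by
      have : 1 - η / m ≤ Real.exp (-(η / m)) := by linarith [Real.add_one_le_exp (-(η / m))]
      refine (pow_le_pow_left₀ (by rw [sub_nonneg, div_le_one hm]; exact hηm) this k).trans_eq ?_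
      rw [← Real.exp_nat_mul, hxdef]
      congr 1
      field_simp
    have e2 : (N.card : ℝ) ^ 2 = Real.exp (2 * l) := by
      rw [hl, mul_comm, Real.exp_mul, Real.exp_log hNpos]; norm_num
    rw [e2]
    refine (mul_le_mul_of_nonneg_left e1 (Real.exp_pos _).le).trans_lt ?_
    rw [← Real.exp_add, Real.exp_lt_one_iff]
    have : 2 * l < k / x := by rw [lt_div_iff₀ hx0]; linarith
    linarith
  have hinj : Set.InjOn (· ∩ T) (N : Set (Finset E)) := by
    intro P hP Q hQ hPQ
    by_contra hPQne
    have hmem : (P, Q) ∈ (N ×ˢ N).filter fun p => p.1 ≠ p.2 ∧ p.1 ∩ T = p.2 ∩ T :=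
      Finset.mem_filter.2 ⟨Finset.mem_product.2 ⟨hP, hQ⟩, hPQne, hPQ⟩
    have : (1 : ℝ) ≤ (((N ×ˢ N).filter fun p => p.1 ≠ p.2 ∧ p.1 ∩ T = p.2 ∩ T).card : ℝ) := by
      exact_mod_cast Finset.card_pos.2 ⟨_, hmem⟩
    linarith
  have hcard : N.card ≤ 2 * (max 2 T.card) ^ D := by
    rw [← Finset.card_image_of_injOn hinj]
    exact htr.card_image_le hTS
  have hmax : ((max 2 T.card : ℕ) : ℝ) ≤ 2 * x * l + 2 := by
    push_cast
    refine max_le (by linarith [show 0 ≤ 2 * x * l by positivity]) ?_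
    have : (T.card : ℝ) ≤ k := by exact_mod_cast hTk
    linarith
  have hfin : l ≤ Real.log 2 + D * Real.log (2 * x * l + 2) := by
    have h2 : (N.card : ℝ) ≤ 2 * (2 * x * l + 2) ^ D := by
      refine (show (N.card : ℝ) ≤ 2 * ((max 2 T.card : ℕ) : ℝ) ^ D by exact_mod_cast hcard).trans ?_
      gcongr
    rw [← Real.log_pow, ← Real.log_mul (by norm_num) (by positivity)]
    exact Real.log_le_log hNpos h2
  rw [← Real.exp_log hNpos]
  exact Real.exp_le_exp.2 (le_of_le_log_add hl0 hx hfin)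

end Packing

/-! ### Random signs: Hoeffding bounds and chaining. -/

section Chaining

open scoped symmDiff

variable {E : Type*} {A : Finset E}

open Classical in
/-- The sum of the `y a`, `a ∈ R`, with signs `+` on `s` and `-` off `s`. -/
noncomputable def signSum (y : E → ℝ) (R s : Finset E) : ℝ :=
  ∑ a ∈ R, if a ∈ s then y a else -y a

lemma half_le_one (A : Finset E) : ∀ a ∈ A, (fun _ : E => (1 / 2 : ℝ≥0)) a ≤ 1 := by
  intro a _
  exact NNReal.half_le_self 1

/-- A sample with all rates `1 / 2` is a uniform sign vector, and `cosh x ≤ exp (x ^ 2 / 2)` bounds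
each factor. -/
lemma sampleExp_exp_signSum_le (z : E → ℝ) (l : ℝ) :
    sampleExp A (fun _ => 1 / 2) (fun s => Real.exp (l * signSum z A s)) ≤
      Real.exp (l ^ 2 / 2 * ∑ a ∈ A, z a ^ 2) := by
  classical
  have key : ∀ s, Real.exp (l * signSum z A s) =
      ∏ a ∈ A, if a ∈ s then Real.exp (l * z a) else Real.exp (-(l * z a)) := by
    intro s
    rw [signSum, Finset.mul_sum, Real.exp_sum]
    refine Finset.prod_congr rfl fun a _ => ?_
    split_ifs <;> simp
  simp only [key]
  rw [sampleExp_prod, Finset.mul_sum, Real.exp_sum]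
  refine Finset.prod_le_prod (fun a _ => ?_) fun a _ => ?_
  · norm_num; positivity
  · have := Real.cosh_le_exp_half_sq (l * z a)
    rw [Real.cosh_eq] at this
    have e : l ^ 2 / 2 * z a ^ 2 = (l * z a) ^ 2 / 2 := by ring
    rw [e]
    push_cast
    linarith

lemma sampleProb_abs_signSum_gt_le {z : E → ℝ} {v t : ℝ} (hv : 0 < v) (ht : 0 ≤ t)
    (hz : ∑ a ∈ A, z a ^ 2 ≤ v) :
    sampleProb A (fun _ => 1 / 2) (fun s => t < |signSum z A s|) ≤
      2 * Real.exp (-(t ^ 2 / (2 * v))) := by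
  have key : ∀ l : ℝ, l ^ 2 = (t / v) ^ 2 →
      sampleProb A (fun _ => 1 / 2) (fun s => t ^ 2 / v < l * signSum z A s) ≤
        Real.exp (-(t ^ 2 / (2 * v))) := by
    intro l hl
    refine (sampleProb_lt_le_exp (half_le_one A) _ _).trans ?_
    refine (mul_le_mul_of_nonneg_left (sampleExp_exp_signSum_le z l) (Real.exp_pos _).le).trans ?_
    rw [← Real.exp_add, hl]
    refine Real.exp_le_exp.2 ?_
    have : (t / v) ^ 2 / 2 * ∑ a ∈ A, z a ^ 2 ≤ (t / v) ^ 2 / 2 * v :=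
      mul_le_mul_of_nonneg_left hz (by positivity)
    have e : (t / v) ^ 2 / 2 * v = t ^ 2 / (2 * v) := by field_simp
    have e2 : t ^ 2 / v = 2 * (t ^ 2 / (2 * v)) := by field_simp
    linarith
  rcases ht.eq_or_lt with rfl | ht'
  · have := sampleProb_add_not A (fun _ => (1 / 2 : ℝ≥0)) (fun s => 0 < |signSum z A s|)
    have h0 := sampleProb_nonneg (half_le_one A) (fun s => ¬ 0 < |signSum z A s|)
    simp only [zero_pow two_ne_zero, zero_div, neg_zero, Real.exp_zero]
    linarith
  -- `l = ± t / v` are the optimal Chernoff parameters for the two tails.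
  have h1 := key (t / v) rfl
  have h2 := key (-(t / v)) (by ring)
  refine ((sampleProb_mono (half_le_one A) fun s _ _ hs => ?_).trans
    (sampleProb_or_le (half_le_one A) (fun s => t ^ 2 / v < t / v * signSum z A s)
      (fun s => t ^ 2 / v < -(t / v) * signSum z A s))).trans (by linarith)
  have hp : 0 < t / v := by positivity
  have e : t ^ 2 / v = t / v * t := by ring
  rcases lt_abs.1 hs with h | h
  · left; rw [e]; exact mul_lt_mul_of_pos_left h hp
  · right; rw [e, neg_mul, ← mul_neg]; exact mul_lt_mul_of_pos_left h hp

open Classical in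
lemma signSum_sub_signSum (y : E → ℝ) {R R' : Finset E} (hR : R ⊆ A) (hR' : R' ⊆ A)
    (s : Finset E) : signSum y R' s - signSum y R s =
      signSum (fun a => (if a ∈ R' then y a else 0) - (if a ∈ R then y a else 0)) A s := by
  have key : ∀ Q ⊆ A, signSum y Q s = signSum (fun a => if a ∈ Q then y a else 0) A s := by
    intro Q hQ
    unfold signSum
    rw [← Finset.sum_subset hQ]
    · exact Finset.sum_congr rfl fun a ha => by simp [ha]
    · intro a _ ha; simp [ha]
  rw [key R hR, key R' hR']
  unfold signSum
  rw [← Finset.sum_sub_distrib]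
  refine Finset.sum_congr rfl fun a _ => ?_
  by_cases ha : a ∈ s
  · simp only [ha, if_true]
  · simp only [ha, if_false]; ring

-- The chaining increment: the two sums differ only on `R ∆ R'`, so its size is the variance proxy.
open Classical in
lemma sampleProb_abs_signSum_sub_gt_le {y : E → ℝ} (hy : ∀ a ∈ A, |y a| ≤ 1) {R R' : Finset E}
    (hR : R ⊆ A) (hR' : R' ⊆ A) {v t : ℝ} (hv : 0 < v) (ht : 0 ≤ t)
    (hRR' : ((R ∆ R').card : ℝ) ≤ v) :
    sampleProb A (fun _ => 1 / 2) (fun s => t < |signSum y R' s - signSum y R s|) ≤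
      2 * Real.exp (-(t ^ 2 / (2 * v))) := by
  simp only [signSum_sub_signSum y hR hR']
  refine sampleProb_abs_signSum_gt_le hv ht (le_trans ?_ hRR')
  have hsub : R ∆ R' ⊆ A := fun a ha => by
    rcases Finset.mem_symmDiff.1 ha with h | h
    exacts [hR h.1, hR' h.1]
  have : ((R ∆ R').card : ℝ) = ∑ a ∈ A, if a ∈ R ∆ R' then (1 : ℝ) else 0 := by
    rw [Finset.sum_ite_mem, Finset.inter_eq_right.2 hsub]; simp
  rw [this]
  refine Finset.sum_le_sum fun a ha => ?_
  have hy2 : y a ^ 2 ≤ 1 := by rw [sq_le_one_iff_abs_le_one]; exact hy a ha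
  by_cases h1 : a ∈ R <;> by_cases h2 : a ∈ R' <;> simp [h1, h2, Finset.mem_symmDiff, hy2]

lemma sampleProb_abs_signSum_subset_gt_le {y : E → ℝ} (hy : ∀ a ∈ A, |y a| ≤ 1) {R : Finset E}
    (hR : R ⊆ A) {v t : ℝ} (hv : 0 < v) (ht : 0 ≤ t) (hRv : (R.card : ℝ) ≤ v) :
    sampleProb A (fun _ => 1 / 2) (fun s => t < |signSum y R s|) ≤
      2 * Real.exp (-(t ^ 2 / (2 * v))) := by
  classical
  have := sampleProb_abs_signSum_sub_gt_le hy (Finset.empty_subset A) hR hv ht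
    (by simpa [symmDiff_def] using hRv)
  simpa [signSum] using this

lemma sum_geometric_three_quarters_le (k : ℕ) : ∑ j ∈ Finset.range k, (3 / 4 : ℝ) ^ j ≤ 4 := by
  have : ∑ j ∈ Finset.range k, (3 / 4 : ℝ) ^ j = 4 * (1 - (3 / 4) ^ k) := by
    rw [geom_sum_eq (by norm_num)]; ring
  rw [this]
  linarith [show (0 : ℝ) ≤ (3 / 4) ^ k by positivity]

lemma sum_half_pow_succ_le (k : ℕ) : ∑ j ∈ Finset.range k, (1 / 2 : ℝ) ^ (j + 1) ≤ 1 := by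
  have : ∑ j ∈ Finset.range k, (1 / 2 : ℝ) ^ (j + 1) = 1 - (1 / 2) ^ k := by
    simp only [pow_succ]
    rw [← Finset.sum_mul, geom_sum_eq (by norm_num)]; ring
  rw [this]
  linarith [show (0 : ℝ) ≤ (1 / 2) ^ k by positivity]

/-- The size of a net at scale `γ / 2 ^ k`. -/
lemma card_le_of_isSeparatedFamily_scale {N : Finset (Finset E)} {S : Finset E} {D : ℕ} {m γ : ℝ}
    (hS : (S.card : ℝ) ≤ m) (hγ : 0 < γ) (k : ℕ) (hN : ∀ R ∈ N, R ⊆ S)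
    (hsep : IsSeparatedFamily (γ / 2 ^ k) N) (htr : HasTraceBound N S D) :
    (N.card : ℝ) ≤ Real.exp (2 + 5 * (k + 1) * (D * Real.log (2 + D * (m / γ)))) := by
  refine (card_le_of_isSeparatedFamily hS (by positivity) hN hsep htr).trans
    (Real.exp_le_exp.2 ?_)
  have hm0 : 0 ≤ m := le_trans (by positivity) hS
  have hx : 0 ≤ D * (m / γ) := by positivity
  -- Refining the scale by `2 ^ k` costs at most a factor `k + 1`, since `2` is at most the argument
  -- of the logarithm on the right.
  have h1 : Real.log (2 + D * (m / (γ / 2 ^ k))) ≤ (k + 1) * Real.log (2 + D * (m / γ)) := by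
    have e : (k + 1) * Real.log (2 + D * (m / γ)) = Real.log ((2 + D * (m / γ)) ^ (k + 1)) := by
      rw [Real.log_pow]; push_cast; ring
    rw [e]
    refine Real.log_le_log (by positivity) ?_
    have e2 : D * (m / (γ / 2 ^ k)) = D * (m / γ) * 2 ^ k := by field_simp
    have h3 : (1 : ℝ) ≤ 2 ^ k := one_le_pow₀ (by norm_num)
    have h2 : (2 : ℝ) ^ k ≤ (2 + D * (m / γ)) ^ k :=
      pow_le_pow_left₀ (by norm_num) (by linarith) k
    rw [e2, pow_succ]
    nlinarith
  have := mul_le_mul_of_nonneg_left h1 (show (0 : ℝ) ≤ 5 * D by positivity)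
  linarith

open Classical in
/-- Relative deviation bound for random signs over a family with few traces, by chaining. -/
lemma sampleProb_exists_signSum_gt_le {F : Finset (Finset E)} {S : Finset E} {D : ℕ} {y : E → ℝ}
    {m γ τ δ : ℝ} (hSA : S ⊆ A) (hy : ∀ a ∈ A, |y a| ≤ 1) (hS : (S.card : ℝ) ≤ m)
    (hF : ∀ R ∈ F, R ⊆ S) (htr : HasTraceBound F S D) (hγ0 : 0 < γ) (hτ : 0 < τ)
    (hδ0 : 0 < δ) (hδ1 : δ < 1)
    (hγ : 32768 * (D * Real.log (2 + D * (m / γ)) + Real.log (2 / δ)) ≤ τ ^ 2 * γ) :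
    sampleProb A (fun _ => 1 / 2)
      (fun s => ∃ R ∈ F, τ * ((R.card : ℝ) + γ) < |signSum y R s|) ≤ δ := by
  have hm0 : 0 ≤ m := le_trans (by positivity) hS
  have hlog2 := Real.log_two_lt_d9
  have hlog2' := Real.log_two_gt_d9
  have hx : 0 ≤ D * (m / γ) := by positivity
  set G := D * Real.log (2 + D * (m / γ)) with hG
  set L := Real.log (2 / δ) with hL
  have hG0 : 0 ≤ G := mul_nonneg (by positivity) (Real.log_nonneg (by linarith))
  have hLlog : Real.log 2 ≤ L := Real.log_le_log (by norm_num)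
    (by rw [le_div_iff₀ hδ0]; linarith)
  have hδ : 2 * Real.exp (-L) = δ := by
    rw [Real.exp_neg, hL, Real.exp_log (by positivity)]; field_simp
  have hnet := fun k : ℕ => exists_separated_net F (show 0 ≤ γ / 2 ^ k by positivity)
  choose N hNF hNsep hNnet using hnet
  choose! π hπN hπ using hNnet
  have hNS : ∀ k, ∀ R ∈ N k, R ⊆ S := fun k R hR => hF R (hNF k hR)
  have hNcard : ∀ k : ℕ, ((N k).card : ℝ) ≤ Real.exp (2 + 5 * (k + 1) * G) := fun k =>
    card_le_of_isSeparatedFamily_scale hS hγ0 k (hNS k) (hNsep k) (htr.mono (hNF k) subset_rfl)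
  -- At level `K` the scale is below `1`, so each `R` is its own approximation and the chain ends
  -- exactly.
  obtain ⟨K, hK⟩ : ∃ K : ℕ, γ < 2 ^ K := pow_unbounded_of_one_lt γ (by norm_num)
  -- The ratio `3 / 4` lies between `1 / √2` and `1`: the thresholds sum to at most `τ * γ / 2`,
  -- while the Hoeffding exponent at level `k` grows like `(3 / 4) ^ (2 * k) * 2 ^ k = (9 / 8) ^ k`
  -- and beats the net sizes.
  set t : ℕ → ℝ := fun k => τ * γ / 8 * (3 / 4) ^ k with ht
  set pairs : ℕ → Finset (Finset E × Finset E) := fun k =>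
    (N k ×ˢ N (k + 1)).filter fun p => ((p.1 ∆ p.2).card : ℝ) ≤ 2 * (γ / 2 ^ k) with hpairs
  set bad0 : Finset E → Prop := fun s =>
    ∃ R ∈ N 0, τ / 4 * ((R.card : ℝ) + γ) < |signSum y R s| with hbad0
  set badk : ℕ → Finset E → Prop := fun k s =>
    ∃ p ∈ pairs k, t k < |signSum y p.2 s - signSum y p.1 s| with hbadk
  have hp0 : sampleProb A (fun _ => 1 / 2) bad0 ≤ δ / 2 := by
    refine (sampleProb_exists_le (half_le_one A) _ _).trans ?_
    have h1 : ∀ R ∈ N 0, sampleProb A (fun _ => 1 / 2)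
        (fun s => τ / 4 * ((R.card : ℝ) + γ) < |signSum y R s|) ≤
          2 * Real.exp (-(τ ^ 2 * γ / 32)) := by
      intro R hR
      have hv : 0 < (R.card : ℝ) + γ := by positivity
      refine (sampleProb_abs_signSum_subset_gt_le hy ((hNS 0 R hR).trans hSA) hv
        (by positivity) (by linarith)).trans ?_
      refine mul_le_mul_of_nonneg_left (Real.exp_le_exp.2 (neg_le_neg ?_)) (by norm_num)
      have e : (τ / 4 * ((R.card : ℝ) + γ)) ^ 2 / (2 * ((R.card : ℝ) + γ)) =
          τ ^ 2 * γ / 32 + τ ^ 2 * R.card / 32 := by field_simp; ring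
      rw [e]
      linarith [show 0 ≤ τ ^ 2 * R.card / 32 by positivity]
    refine (Finset.sum_le_card_nsmul _ _ _ h1).trans ?_
    rw [nsmul_eq_mul, ← hδ]
    have h2 := hNcard 0
    refine (mul_le_mul_of_nonneg_right h2 (by positivity)).trans ?_
    rw [mul_left_comm, ← Real.exp_add]
    have h3 : Real.exp (2 + 5 * ((0 : ℕ) + 1) * G + -(τ ^ 2 * γ / 32)) ≤
        Real.exp (-L - Real.log 2) := Real.exp_le_exp.2 (by push_cast; linarith)
    rw [Real.exp_sub, Real.exp_log (by norm_num)] at h3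
    linarith
  have hpk : ∀ k, sampleProb A (fun _ => 1 / 2) (badk k) ≤ δ / 2 * (1 / 2) ^ (k + 1) := by
    intro k
    refine (sampleProb_exists_le (half_le_one A) _ _).trans ?_
    have h1 : ∀ p ∈ pairs k, sampleProb A (fun _ => 1 / 2)
        (fun s => t k < |signSum y p.2 s - signSum y p.1 s|) ≤
          2 * Real.exp (-(16 * (k + 1) * (G + L))) := by
      intro p hp
      obtain ⟨hpN, hpc⟩ := Finset.mem_filter.1 hp
      obtain ⟨hp1, hp2⟩ := Finset.mem_product.1 hpN
      refine (sampleProb_abs_signSum_sub_gt_le hy ((hNS _ _ hp1).trans hSA)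
        ((hNS _ _ hp2).trans hSA) (by positivity) (by positivity) hpc).trans ?_
      refine mul_le_mul_of_nonneg_left (Real.exp_le_exp.2 (neg_le_neg ?_)) (by norm_num)
      have e : t k ^ 2 / (2 * (2 * (γ / 2 ^ k))) = τ ^ 2 * γ / 256 * (9 / 8) ^ k := by
        have e1 : (9 / 8 : ℝ) ^ k = (3 / 4) ^ k * (3 / 4) ^ k * 2 ^ k := by
          rw [← mul_pow, ← mul_pow]; norm_num
        rw [e1, ht]
        field_simp
        ring
      rw [e]
      -- By Bernoulli, `(9 / 8) ^ k ≥ (k + 1) / 8`; hence `32768 / 256 / 8 = 16` against the `15` in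
      -- the logarithm of the number of pairs.
      have hb := one_add_mul_le_pow (show (-2 : ℝ) ≤ 1 / 8 by norm_num) k
      have hb' : ((k : ℝ) + 1) / 8 ≤ (9 / 8) ^ k := by
        have : (1 + 1 / 8 : ℝ) = 9 / 8 := by norm_num
        rw [this] at hb
        linarith
      have hHk : 0 ≤ G + L := by linarith
      calc 16 * (k + 1) * (G + L) = 32768 * (G + L) / 256 * ((k + 1) / 8) := by ring
        _ ≤ τ ^ 2 * γ / 256 * (9 / 8) ^ k := by gcongr
    refine (Finset.sum_le_card_nsmul _ _ _ h1).trans ?_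
    rw [nsmul_eq_mul, ← hδ]
    have hk0 : (0 : ℝ) ≤ k := by positivity
    have h2 : ((pairs k).card : ℝ) ≤ Real.exp (4 + 15 * (k + 1) * G) := by
      have h3 : (pairs k).card ≤ (N k).card * (N (k + 1)).card :=
        (Finset.card_filter_le _ _).trans (Finset.card_product _ _).le
      have h4 : ((pairs k).card : ℝ) ≤ (N k).card * (N (k + 1)).card := by exact_mod_cast h3
      refine h4.trans ((mul_le_mul (hNcard k) (hNcard (k + 1)) (by positivity)
        (Real.exp_pos _).le).trans ?_)
      rw [← Real.exp_add]
      refine Real.exp_le_exp.2 ?_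
      push_cast
      nlinarith [mul_nonneg hk0 hG0]
    refine (mul_le_mul_of_nonneg_right h2 (by positivity)).trans ?_
    rw [mul_left_comm, ← Real.exp_add]
    have e5 : (1 / 2 : ℝ) ^ (k + 1) = Real.exp (-((k + 1) * Real.log 2)) := by
      rw [Real.exp_neg, show ((k : ℝ) + 1) * Real.log 2 = ((k + 1 : ℕ) : ℝ) * Real.log 2 by
        push_cast; ring, Real.exp_nat_mul, Real.exp_log (by norm_num), one_div, inv_pow]
    have h6 : Real.exp (4 + 15 * (k + 1) * G + -(16 * (k + 1) * (G + L))) ≤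
        Real.exp (-L + -((k + 1) * Real.log 2) - Real.log 2) := by
      refine Real.exp_le_exp.2 ?_
      nlinarith [mul_nonneg hk0 hG0, mul_nonneg hk0 (sub_nonneg.2 hLlog)]
    rw [Real.exp_sub, Real.exp_log (by norm_num), Real.exp_add (-L), ← e5] at h6
    linarith
  have hincl : ∀ s, (∃ R ∈ F, τ * ((R.card : ℝ) + γ) < |signSum y R s|) →
      bad0 s ∨ ∃ k ∈ Finset.range K, badk k s := by
    rintro s ⟨R, hR, hlt⟩
    by_contra hcon
    push Not at hcon
    obtain ⟨hg0, hgk⟩ := hcon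
    simp only [hbad0, not_exists, not_and, not_lt] at hg0
    have hind : ∀ k ≤ K, |signSum y (π k R) s| ≤
        τ / 4 * (((π 0 R).card : ℝ) + γ) + ∑ j ∈ Finset.range k, t j := by
      intro k hk
      induction k with
      | zero => simpa using hg0 _ (hπN 0 R hR)
      | succ k ih =>
        have ih := ih (by omega)
        have hgk := hgk k (Finset.mem_range.2 (by omega))
        simp only [hbadk, not_exists, not_and, not_lt] at hgk
        have hmem : (π k R, π (k + 1) R) ∈ pairs k := by
          refine Finset.mem_filter.2 ⟨Finset.mem_product.2 ⟨hπN k R hR, hπN _ R hR⟩, ?_⟩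
          have h1 := Finset.card_le_card (symmDiff_triangle (π k R) R (π (k + 1) R))
          have h2 : ((π k R ∆ π (k + 1) R).card : ℝ) ≤
              (π k R ∆ R).card + (R ∆ π (k + 1) R).card := by
            exact_mod_cast h1.trans (Finset.card_union_le _ _)
          have h3 := hπ k R hR
          have h4 := hπ (k + 1) R hR
          rw [symmDiff_comm] at h3
          have h5 : γ / 2 ^ (k + 1) ≤ γ / 2 ^ k := by
            gcongr
            · norm_num
            · omega
          linarith
        have h6 := hgk _ hmem
        rw [Finset.sum_range_succ]
        have h7 := abs_sub_abs_le_abs_sub (signSum y (π (k + 1) R) s) (signSum y (π k R) s)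
        dsimp only at h6
        linarith
    have hKR : π K R = R := by
      have h1 := hπ K R hR
      have h2 : γ / 2 ^ K < 1 := by rw [div_lt_one (by positivity)]; exact hK
      have h3 : (R ∆ π K R).card = 0 := by
        have : ((R ∆ π K R).card : ℝ) < 1 := h1.trans_lt h2
        have : (R ∆ π K R).card < 1 := by exact_mod_cast this
        omega
      rw [Finset.card_eq_zero] at h3
      exact (symmDiff_eq_bot.1 h3).symm
    have hfin := hind K le_rfl
    rw [hKR] at hfin
    have hsum : ∑ j ∈ Finset.range K, t j ≤ τ * γ / 2 := by
      rw [ht, ← Finset.mul_sum]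
      have := mul_le_mul_of_nonneg_left (sum_geometric_three_quarters_le K)
        (show 0 ≤ τ * γ / 8 by positivity)
      linarith
    -- The total is then at most `τ / 4 * (|R| + 2 * γ) + τ * γ / 2`, which is below `τ * (|R| +
    -- γ)`.
    have hc0 : ((π 0 R).card : ℝ) ≤ R.card + γ := by
      have h1 := hπ 0 R hR
      rw [pow_zero, div_one] at h1
      have h2 : π 0 R ⊆ R ∪ R ∆ π 0 R := by
        intro a ha
        by_cases haR : a ∈ R
        · exact Finset.mem_union_left _ haR
        · exact Finset.mem_union_right _ (Finset.mem_symmDiff.2 (Or.inr ⟨ha, haR⟩))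
      have h3 : ((π 0 R).card : ℝ) ≤ R.card + (R ∆ π 0 R).card := by
        exact_mod_cast (Finset.card_le_card h2).trans (Finset.card_union_le _ _)
      linarith
    have h9 := mul_le_mul_of_nonneg_left hc0 (show 0 ≤ τ / 4 by positivity)
    have h10 : 0 ≤ τ * R.card := by positivity
    nlinarith
  refine (sampleProb_mono (half_le_one A) fun s _ _ hs => hincl s hs).trans ?_
  refine (sampleProb_or_le (half_le_one A) _ _).trans ?_
  have h1 := (sampleProb_exists_le (half_le_one A) (Finset.range K) badk).trans
    (Finset.sum_le_sum fun k _ => hpk k)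
  rw [← Finset.mul_sum] at h1
  have h2 := mul_le_mul_of_nonneg_left (sum_half_pow_succ_le K) (show 0 ≤ δ / 2 by positivity)
  linarith

end Chaining

/-! ### Symmetrization: from one sample to random signs on a pair of samples. -/

section Symmetrization

open scoped symmDiff

variable {E : Type*} {A : Finset E} {q : E → ℝ≥0}

open Classical in
/-- Exchanges the parts of `B` and `B'` off `s`; this is the new first set. -/
noncomputable def exchange (s B B' : Finset E) : Finset E := (B ∩ s) ∪ (B' \ s)

lemma mem_exchange {s B B' : Finset E} {a : E} :
    a ∈ exchange s B B' ↔ (a ∈ s ∧ a ∈ B) ∨ (a ∉ s ∧ a ∈ B') := by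
  classical
  simp [exchange]; tauto

lemma exchange_exchange (s B B' : Finset E) :
    exchange s (exchange s B B') (exchange s B' B) = B := by
  ext a; simp only [mem_exchange]; tauto

lemma exchange_subset {s B B' : Finset E} (hB : B ⊆ A) (hB' : B' ⊆ A) : exchange s B B' ⊆ A := by
  intro a ha
  rcases mem_exchange.1 ha with h | h
  exacts [hB h.2, hB' h.2]

open Classical in
lemma exchange_symmDiff_exchange (s B B' : Finset E) :
    exchange s B B' ∆ exchange s B' B = B ∆ B' := by
  ext a; simp only [Finset.mem_symmDiff, mem_exchange]; tauto

open Classical in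
lemma sampleMass_eq_prod {B : Finset E} (hB : B ⊆ A) :
    sampleMass A q B = ∏ a ∈ A, if a ∈ B then (q a : ℝ) else 1 - q a := by
  rw [← Finset.prod_sdiff hB]
  rw [Finset.prod_congr rfl (g := fun a => 1 - (q a : ℝ)) (s₁ := A \ B) fun a ha => by
    simp [(Finset.mem_sdiff.1 ha).2]]
  rw [Finset.prod_congr rfl (g := fun a => (q a : ℝ)) (s₁ := B) fun a ha => by simp [ha]]
  rw [sampleMass, mul_comm]

lemma sampleMass_mul_sampleMass_exchange (s : Finset E) {B B' : Finset E} (hB : B ⊆ A)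
    (hB' : B' ⊆ A) :
    sampleMass A q (exchange s B B') * sampleMass A q (exchange s B' B) =
      sampleMass A q B * sampleMass A q B' := by
  classical
  rw [sampleMass_eq_prod (exchange_subset hB hB'), sampleMass_eq_prod (exchange_subset hB' hB),
    sampleMass_eq_prod hB, sampleMass_eq_prod hB', ← Finset.prod_mul_distrib,
    ← Finset.prod_mul_distrib]
  refine Finset.prod_congr rfl fun a _ => ?_
  simp only [mem_exchange]
  by_cases hs : a ∈ s <;> simp [hs, mul_comm]

/-- Exchanging is an involution on pairs of outcomes that preserves the product mass. -/
lemma sampleExp_sampleExp_exchange (s : Finset E) (Φ : Finset E → Finset E → ℝ) :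
    sampleExp A q (fun B => sampleExp A q fun B' => Φ (exchange s B B') (exchange s B' B)) =
      sampleExp A q (fun B => sampleExp A q fun B' => Φ B B') := by
  classical
  have key : ∀ Ψ : Finset E → Finset E → ℝ,
      sampleExp A q (fun B => sampleExp A q fun B' => Ψ B B') =
        ∑ p ∈ A.powerset ×ˢ A.powerset, sampleMass A q p.1 * sampleMass A q p.2 * Ψ p.1 p.2 := by
    intro Ψ
    rw [Finset.sum_product]
    simp only [sampleExp, Finset.mul_sum, mul_assoc]
  rw [key, key]
  have hmem : ∀ p ∈ A.powerset ×ˢ A.powerset,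
      (exchange s p.1 p.2, exchange s p.2 p.1) ∈ A.powerset ×ˢ A.powerset := by
    intro p hp
    obtain ⟨h1, h2⟩ := Finset.mem_product.1 hp
    rw [Finset.mem_powerset] at h1 h2
    exact Finset.mem_product.2 ⟨Finset.mem_powerset.2 (exchange_subset h1 h2),
      Finset.mem_powerset.2 (exchange_subset h2 h1)⟩
  refine Finset.sum_nbij' (fun p => (exchange s p.1 p.2, exchange s p.2 p.1))
    (fun p => (exchange s p.1 p.2, exchange s p.2 p.1)) hmem hmem ?_ ?_ ?_
  · intro p _; simp [exchange_exchange]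
  · intro p _; simp [exchange_exchange]
  · intro p hp
    obtain ⟨h1, h2⟩ := Finset.mem_product.1 hp
    rw [Finset.mem_powerset] at h1 h2
    dsimp only
    rw [sampleMass_mul_sampleMass_exchange s h1 h2]

lemma sampleExp_comm (A : Finset E) (q q' : E → ℝ≥0) (Φ : Finset E → Finset E → ℝ) :
    sampleExp A q (fun B => sampleExp A q' fun B' => Φ B B') =
      sampleExp A q' (fun B' => sampleExp A q fun B => Φ B B') := by
  simp only [sampleExp, Finset.mul_sum]
  rw [Finset.sum_comm]
  exact Finset.sum_congr rfl fun _ _ => Finset.sum_congr rfl fun _ _ => by ring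

open Classical in
/-- Symmetrization for an event on pairs of samples. -/
lemma sampleExp_sampleProb_le_of_exchange (hq : ∀ a ∈ A, q a ≤ 1) {Ψ : Finset E → Finset E → Prop}
    {δ : ℝ} (h : ∀ B ⊆ A, ∀ B' ⊆ A, sampleProb A (fun _ => 1 / 2)
      (fun s => Ψ (exchange s B B') (exchange s B' B)) ≤ δ) :
    sampleExp A q (fun B => sampleProb A q fun B' => Ψ B B') ≤ δ := by
  simp only [sampleProb_eq_sampleExp] at h ⊢
  -- The quantity does not depend on `s`, so it may be averaged over a uniform `s`. The order of
  -- expectations is then swapped, leaving `B` and `B'` fixed and only `s` random.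
  rw [← sampleExp_const A (fun _ => 1 / 2) (sampleExp A q _)]
  have h1 : (fun _ : Finset E => sampleExp A q fun B => sampleExp A q fun B' =>
      if Ψ B B' then (1 : ℝ) else 0) = fun s => sampleExp A q fun B => sampleExp A q fun B' =>
      if Ψ (exchange s B B') (exchange s B' B) then 1 else 0 := by
    ext s
    exact (sampleExp_sampleExp_exchange s fun B B' => if Ψ B B' then (1 : ℝ) else 0).symm
  rw [h1, sampleExp_comm]
  rw [← sampleExp_const A q δ]
  refine sampleExp_mono hq fun B hB _ => ?_
  rw [sampleExp_comm, ← sampleExp_const A q δ]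
  exact sampleExp_mono hq fun B' hB' _ => h B hB B' hB'

open Classical in
/-- The difference of the indicators of `B` and `B'`. -/
noncomputable def indicatorDiff (B B' : Finset E) (a : E) : ℝ :=
  (if a ∈ B then 1 else 0) - (if a ∈ B' then 1 else 0)

lemma abs_indicatorDiff_le (B B' : Finset E) (a : E) : |indicatorDiff B B' a| ≤ 1 := by
  unfold indicatorDiff
  split_ifs <;> norm_num

-- This turns exchanges into signs: the sum over `R ∩ (B ∆ B')` becomes a `signSum` in `s`.
open Classical in
lemma indicatorDiff_exchange (s B B' : Finset E) (a : E) :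
    indicatorDiff (exchange s B B') (exchange s B' B) a =
      if a ∈ s then indicatorDiff B B' a else -indicatorDiff B B' a := by
  unfold indicatorDiff
  by_cases hs : a ∈ s <;> simp [mem_exchange, hs]

open Classical in
lemma deviation_sub_deviation (q : E → ℝ≥0) (R B B' : Finset E) :
    deviation q R B - deviation q R B' = ∑ a ∈ R ∩ (B ∆ B'), indicatorDiff B B' a := by
  rw [deviation, deviation, ← Finset.sum_sub_distrib, ← Finset.sum_subset
    (Finset.inter_subset_left (s₁ := R) (s₂ := B ∆ B'))]
  · exact Finset.sum_congr rfl fun a _ => by unfold indicatorDiff; ring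
  · intro a ha ha'
    have : ¬ a ∈ B ∆ B' := fun h => ha' (Finset.mem_inter.2 ⟨ha, h⟩)
    rw [Finset.mem_symmDiff] at this
    by_cases h1 : a ∈ B <;> by_cases h2 : a ∈ B' <;> simp_all

open Classical in
lemma card_inter_symmDiff_le (q : E → ℝ≥0) (R B B' : Finset E) :
    ((R ∩ (B ∆ B')).card : ℝ) ≤ deviation q R B + deviation q R B' + 2 * ∑ a ∈ R, (q a : ℝ) := by
  rw [deviation, deviation, Finset.mul_sum, ← Finset.sum_add_distrib, ← Finset.sum_add_distrib]
  rw [Finset.card_eq_sum_ones, Nat.cast_sum, ← Finset.sum_ite_mem]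
  refine Finset.sum_le_sum fun a _ => ?_
  by_cases h1 : a ∈ B <;> by_cases h2 : a ∈ B' <;> simp [h1, h2, Finset.mem_symmDiff] <;> linarith

open Classical in
/-- Two independent samples differ much on some range. -/
def PairDeviates (F : Finset (Finset E)) (m γ τ : ℝ) (B B' : Finset E) : Prop :=
  ((B ∆ B').card : ℝ) ≤ m ∧ ∃ R ∈ F, τ * (((R ∩ (B ∆ B')).card : ℝ) + γ) <
    |∑ a ∈ R ∩ (B ∆ B'), indicatorDiff B B' a|

lemma sampleProb_pairDeviates_exchange_le {F : Finset (Finset E)} {D : ℕ} {m γ τ δ : ℝ}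
    (htr : HasTraceBound F A D) (hγ0 : 0 < γ) (hτ : 0 < τ) (hδ0 : 0 < δ) (hδ1 : δ < 1)
    (hγ : 32768 * (D * Real.log (2 + D * (m / γ)) + Real.log (2 / δ)) ≤ τ ^ 2 * γ)
    {B B' : Finset E} (hB : B ⊆ A) (hB' : B' ⊆ A) :
    sampleProb A (fun _ => 1 / 2)
      (fun s => PairDeviates F m γ τ (exchange s B B') (exchange s B' B)) ≤ δ := by
  classical
  unfold PairDeviates
  -- The set `B ∆ B'`, and with it the size condition, is invariant under exchange; only the signs
  -- depend on `s`.
  simp only [exchange_symmDiff_exchange, indicatorDiff_exchange]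
  set S := B ∆ B' with hS
  have hSA : S ⊆ A := fun a ha => by
    rcases Finset.mem_symmDiff.1 ha with h | h
    exacts [hB h.1, hB' h.1]
  rcases le_or_gt (S.card : ℝ) m with hm | hm
  · have htr' : HasTraceBound (F.image (· ∩ S)) S D := by
      intro T hT h2
      refine le_trans (le_of_eq ?_) (htr T (hT.trans hSA) h2)
      rw [Finset.image_image]
      congr 1
      refine Finset.image_congr fun R _ => ?_
      simp only [Function.comp, Finset.inter_assoc, Finset.inter_eq_right.2 hT]
    refine (sampleProb_mono (half_le_one A) fun s _ _ hs => ?_).trans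
      (sampleProb_exists_signSum_gt_le (y := indicatorDiff B B') hSA
        (fun a _ => abs_indicatorDiff_le B B' a) hm (F := F.image (· ∩ S)) ?_ htr' hγ0 hτ hδ0 hδ1 hγ)
    · obtain ⟨_, R, hR, h⟩ := hs
      exact ⟨R ∩ S, Finset.mem_image_of_mem _ hR, h⟩
    · intro R hR
      obtain ⟨Q, _, rfl⟩ := Finset.mem_image.1 hR
      exact Finset.inter_subset_right
  · refine le_trans (sampleProb_mono (Q := fun _ => False) (half_le_one A) fun s _ _ hs => ?_) ?_
    · exact absurd hs.1 (not_le.2 hm)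
    · rw [sampleProb_eq_sampleExp]
      simp only [if_false]
      rw [sampleExp_const]
      exact hδ0.le

lemma exp_neg_le_eighth {x : ℝ} (hx : 7 ≤ x) : Real.exp (-x) ≤ 1 / 8 := by
  rw [Real.exp_neg, ← one_div]
  exact one_div_le_one_div_of_le (by norm_num) (by linarith [Real.add_one_le_exp x])

/-- If a sample deviates on a range, then a pair of samples does so with probability `1 / 2`. -/
lemma half_le_sampleProb_pairDeviates {F : Finset (Finset E)} {m γ ε : ℝ}
    (hq : ∀ a ∈ A, q a ≤ 1) (hF : ∀ R ∈ F, R ⊆ A) (hm : ∑ a ∈ A, (q a : ℝ) ≤ m) (hγ0 : 0 < γ)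
    (hγm : γ ≤ m) (hε0 : 0 < ε) (hε1 : ε < 1) (hγ : 896 ≤ ε ^ 2 * γ) {B : Finset E}
    (hB : (B.card : ℝ) ≤ 2 * m)
    (hdev : ∃ R ∈ F, ε / 2 * (∑ a ∈ R, (q a : ℝ) + γ) < |deviation q R B|) :
    1 / 2 ≤ sampleProb A q (PairDeviates F (4 * m) γ (ε / 12) B) := by
  classical
  obtain ⟨R, hR, hdev⟩ := hdev
  have hQ0 : 0 ≤ ∑ a ∈ R, (q a : ℝ) := Finset.sum_nonneg fun a _ => (q a).2
  -- For this one range, `B'` deviates by more than `ε / 8 * (Q + γ)` with probability at most `2 *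
  -- exp (-(ε ^ 2 * γ / 128)) ≤ 1 / 4`, as `896 = 7 * 128`. Being too large costs another `1 / 8`.
  have h1 := sampleProb_abs_deviation_gt_le hq (hF R hR) (l := ε / 16) (by positivity)
    (by linarith) (ε / 8 * (∑ a ∈ R, (q a : ℝ) + γ))
  have h2 := sampleProb_card_gt_le hq hm
  set Q := ∑ a ∈ R, (q a : ℝ) with hQ
  have h3 : Real.exp ((ε / 16) ^ 2 * Q - ε / 16 * (ε / 8 * (Q + γ))) ≤ 1 / 8 := by
    refine le_trans (Real.exp_le_exp.2 ?_) (exp_neg_le_eighth (x := ε ^ 2 * γ / 128)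
      (by linarith))
    nlinarith [mul_nonneg (sq_nonneg ε) hQ0]
  have h4 : Real.exp (-(m / 4)) ≤ 1 / 8 := by
    refine exp_neg_le_eighth ?_
    nlinarith
  have h5 := sampleProb_or_le hq (fun B' => ε / 8 * (Q + γ) < |deviation q R B'|)
    (fun B' => 2 * m < (B'.card : ℝ))
  have h6 := sampleProb_add_not A q
    (fun B' => ε / 8 * (Q + γ) < |deviation q R B'| ∨ 2 * m < (B'.card : ℝ))
  have hhalf : 1 / 2 ≤ sampleProb A q
      (fun B' => ¬(ε / 8 * (Q + γ) < |deviation q R B'| ∨ 2 * m < (B'.card : ℝ))) := by linarith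
  refine hhalf.trans (sampleProb_mono hq fun B' _ _ hB' => ?_)
  · push Not at hB'
    obtain ⟨hd', hc'⟩ := hB'
    refine ⟨?_, R, hR, ?_⟩
    · have : (B ∆ B').card ≤ B.card + B'.card := by
        refine (Finset.card_le_card ?_).trans (Finset.card_union_le B B')
        exact symmDiff_le_sup
      have : ((B ∆ B').card : ℝ) ≤ B.card + B'.card := by exact_mod_cast this
      linarith
    · rw [← deviation_sub_deviation q]
      have h7 := card_inter_symmDiff_le q R B B'
      have h8 := abs_sub_abs_le_abs_sub (deviation q R B) (deviation q R B')
      have h9 : deviation q R B + deviation q R B' ≤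
          |deviation q R B - deviation q R B'| + 2 * |deviation q R B'| := by
        linarith [le_abs_self (deviation q R B - deviation q R B'),
          le_abs_self (deviation q R B')]
      set Δ := |deviation q R B - deviation q R B'|
      -- `3 / 8 = 1 / 2 - 1 / 8`. With `h11`, the penalty `ε / 12 * (Δ + 3 * (Q + γ))` is at most `Δ
      -- / 12 + 2 * Δ / 3 < Δ`.
      have h10 : 3 * ε / 8 * (Q + γ) < Δ := by linarith
      have h11 : ((R ∩ (B ∆ B')).card : ℝ) + γ ≤ Δ + 3 * (Q + γ) := by
        rw [← hQ] at h7
        nlinarith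
      have h12 := mul_le_mul_of_nonneg_left h11 (show 0 ≤ ε / 12 by positivity)
      have hΔ : 0 ≤ Δ := abs_nonneg _
      nlinarith

/-- Relative deviation bound for an independent sample over a family with few traces. -/
lemma sampleProb_exists_deviation_gt_le {F : Finset (Finset E)} {D : ℕ} {m γ ε δ : ℝ}
    (hq : ∀ a ∈ A, q a ≤ 1) (hF : ∀ R ∈ F, R ⊆ A) (htr : HasTraceBound F A D)
    (hm : ∑ a ∈ A, (q a : ℝ) ≤ m) (hγ0 : 0 < γ) (hγm : γ ≤ m) (hε0 : 0 < ε) (hε1 : ε < 1)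
    (hδ0 : 0 < δ) (hδ1 : δ < 1)
    (hγ : 18874368 * (D * Real.log (2 + D * (4 * m / γ)) + Real.log (2 / δ)) ≤ ε ^ 2 * γ) :
    sampleProb A q (fun B => (B.card : ℝ) ≤ 2 * m ∧
      ∃ R ∈ F, ε / 2 * (∑ a ∈ R, (q a : ℝ) + γ) < |deviation q R B|) ≤ δ / 4 := by
  classical
  have hlog2' := Real.log_two_gt_d9
  have hm0 : 0 ≤ m := by linarith
  have hG0 : 0 ≤ D * Real.log (2 + D * (4 * m / γ)) := mul_nonneg (by positivity)
    (Real.log_nonneg (by linarith [show 0 ≤ D * (4 * m / γ) by positivity]))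
  have hLlog : Real.log 2 ≤ Real.log (2 / δ) := Real.log_le_log (by norm_num)
    (by rw [le_div_iff₀ hδ0]; linarith)
  have hL8 : Real.log (2 / (δ / 8)) = Real.log (2 / δ) + 3 * Real.log 2 := by
    rw [show 2 / (δ / 8) = 2 / δ * 2 ^ 3 by field_simp; norm_num,
      Real.log_mul (by positivity) (by norm_num), Real.log_pow]
    norm_num
  -- The constant is `18874368 = 32768 * 12 ^ 2 * 4`: `12` from `τ = ε / 12`, and `4` because `log
  -- (16 / δ) ≤ 4 * log (2 / δ)`.
  have h1 : ∀ B ⊆ A, ∀ B' ⊆ A, sampleProb A (fun _ => 1 / 2)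
      (fun s => PairDeviates F (4 * m) γ (ε / 12) (exchange s B B') (exchange s B' B)) ≤ δ / 8 :=
    fun B hB B' hB' => sampleProb_pairDeviates_exchange_le htr hγ0 (by positivity) (by positivity)
      (by linarith) (by rw [hL8]; nlinarith) hB hB'
  have h2 := sampleExp_sampleProb_le_of_exchange hq h1
  have h3 : sampleProb A q (fun B => (B.card : ℝ) ≤ 2 * m ∧
      ∃ R ∈ F, ε / 2 * (∑ a ∈ R, (q a : ℝ) + γ) < |deviation q R B|) ≤
      sampleExp A q (fun B => 2 * sampleProb A q (PairDeviates F (4 * m) γ (ε / 12) B)) := by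
    rw [sampleProb_eq_sampleExp]
    refine sampleExp_mono hq fun B _ _ => ?_
    split_ifs with h
    · have := half_le_sampleProb_pairDeviates hq hF hm hγ0 hγm hε0 hε1 (by nlinarith) h.1 h.2
      linarith
    · have := sampleProb_nonneg hq (PairDeviates F (4 * m) γ (ε / 12) B)
      linarith
  rw [sampleExp_const_mul] at h3
  linarith

end Symmetrization

/-! ### Layer-cake summation. -/

section LayerCake

open MeasureTheory

lemma setIntegral_Ico_indicator_Iio {g M : ℝ} (hg : 0 ≤ g) (hM : 0 ≤ M) :
    ∫ t in Set.Ico 0 M, (Set.Iio g).indicator (fun _ => (1 : ℝ)) t = min g M := by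
  rw [integral_indicator measurableSet_Iio, Measure.restrict_restrict measurableSet_Iio,
    Set.inter_comm, Set.Ico_inter_Iio, setIntegral_const, smul_eq_mul, mul_one,
    Real.volume_real_Ico_of_le (le_min hM hg), sub_zero, min_comm]

-- Integrates the hypothesis over `t ∈ [0, M)`, using `min (g a) M = ∫ 1[t < g a] dt`.
open Classical in
lemma sum_mul_min_le {E : Type*} {s : Finset E} {z g : E → ℝ} {κ M : ℝ} (hM : 0 ≤ M)
    (hg : ∀ a ∈ s, 0 ≤ g a) (h : ∀ t, 0 ≤ t → ∑ a ∈ s.filter (fun a => t < g a), z a ≤ κ) :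
    ∑ a ∈ s, z a * min (g a) M ≤ κ * M := by
  have hint : ∀ a ∈ s, Integrable (fun t => z a * (Set.Iio (g a)).indicator (fun _ => (1 : ℝ)) t)
      (volume.restrict (Set.Ico 0 M)) := fun a _ =>
    ((integrable_const (1 : ℝ)).indicator measurableSet_Iio).const_mul _
  have e1 : ∑ a ∈ s, z a * min (g a) M = ∫ t in Set.Ico 0 M,
      ∑ a ∈ s, z a * (Set.Iio (g a)).indicator (fun _ => (1 : ℝ)) t := by
    rw [integral_finsetSum _ hint]
    refine Finset.sum_congr rfl fun a ha => ?_
    rw [integral_const_mul, setIntegral_Ico_indicator_Iio (hg a ha) hM]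
  have e2 : κ * M = ∫ _ in Set.Ico 0 M, κ := by
    rw [setIntegral_const, Real.volume_real_Ico_of_le hM, smul_eq_mul, sub_zero, mul_comm]
  rw [e1, e2]
  refine setIntegral_mono_on (integrable_finsetSum _ hint) (integrable_const _)
    measurableSet_Ico fun t ht => ?_
  refine le_trans (le_of_eq ?_) (h t ht.1)
  rw [Finset.sum_filter]
  refine Finset.sum_congr rfl fun a _ => ?_
  by_cases hta : t < g a <;> simp [hta]

end LayerCake

/-! ### Importance sampling by sensitivities. -/

section ImportanceSampling

variable {E X : Type*} {cost : E → X → ℝ≥0} {A : Finset E}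

open Classical in
lemma rangeTraces_subset_powerset (cost : E → X → ℝ≥0) (w : E → ℝ≥0) (S : Finset E) :
    rangeTraces cost w S ⊆ (S.powerset : Set (Finset E)) := by
  rintro R ⟨x, r, rfl⟩
  exact Finset.mem_coe.2 (Finset.mem_powerset.2 (Finset.filter_subset _ _))

lemma ncard_rangeTraces_le_pow_systemDim (cost : E → X → ℝ≥0) (A : Finset E) (w : E → ℝ≥0) :
    ∀ S ⊆ A, 2 ≤ S.card → (rangeTraces cost w S).ncard ≤ S.card ^ systemDim cost A w := by
  -- Without an admissible exponent the infimum would be the default `0`; `|A|` is one, as `2 ^ |S|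
  -- ≤ |S| ^ |S|`.
  have hne : {D : ℕ | ∀ S ⊆ A, 2 ≤ S.card →
      (rangeTraces cost w S).ncard ≤ S.card ^ D}.Nonempty := by
    refine ⟨A.card, fun S hS h2 => ?_⟩
    calc (rangeTraces cost w S).ncard ≤ (S.powerset : Set (Finset E)).ncard :=
          Set.ncard_le_ncard (rangeTraces_subset_powerset cost w S) (Finset.finite_toSet _)
      _ = 2 ^ S.card := by rw [Set.ncard_coe_finset, Finset.card_powerset]
      _ ≤ S.card ^ S.card := Nat.pow_le_pow_left h2 _
      _ ≤ S.card ^ A.card := Nat.pow_le_pow_right (by omega) (Finset.card_le_card hS)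
  exact Nat.sInf_mem hne

open Classical in
/-- The complements of the ranges in `A`. -/
noncomputable def superlevelFamily (cost : E → X → ℝ≥0) (A : Finset E) (w : E → ℝ≥0) :
    Finset (Finset E) :=
  A.powerset.filter fun R => ∃ (x : X) (r : ℝ≥0), R = A.filter fun a => r < w a * cost a x

lemma hasTraceBound_superlevelFamily (cost : E → X → ℝ≥0) (A : Finset E) (w : E → ℝ≥0) :
    HasTraceBound (superlevelFamily cost A w) A (systemDim cost A w) := by
  classical
  intro T hT h2
  refine le_trans ?_ (ncard_rangeTraces_le_pow_systemDim cost A w T hT h2)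
  have hfin : (rangeTraces cost w T).Finite :=
    (Finset.finite_toSet _).subset (rangeTraces_subset_powerset cost w T)
  -- Traces of superlevel sets are complements in `T` of traces of ranges, so there are no more of
  -- them.
  refine le_trans ?_ (Set.ncard_image_le (f := fun Q => T \ Q) hfin)
  rw [← Set.ncard_coe_finset]
  refine Set.ncard_le_ncard ?_ (hfin.image _)
  intro Q hQ
  obtain ⟨R, hR, rfl⟩ := Finset.mem_image.1 (Finset.mem_coe.1 hQ)
  obtain ⟨_, x, r, rfl⟩ := Finset.mem_filter.1 hR
  refine ⟨_, ⟨x, r, rfl⟩, ?_⟩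
  ext a
  simp only [Finset.mem_sdiff, Finset.mem_filter, Finset.mem_inter, not_and, not_le]
  constructor
  · rintro ⟨h1, h3⟩; exact ⟨⟨hT h1, h3 h1⟩, h1⟩
  · rintro ⟨⟨_, h3⟩, h1⟩; exact ⟨h1, fun _ => h3⟩

lemma samplingRate_le_one (γ : ℝ≥0) (u : E → ℝ≥0) (a : E) : samplingRate γ u a ≤ 1 :=
  min_le_left _ _

lemma cost_ofFinset (cost : E → X → ℝ≥0) (A : Finset E) (x : X) :
    (WeightedSet.ofFinset A).cost cost x = ∑ a ∈ A, cost a x := by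
  simp [WeightedSet.ofFinset, WeightedSet.cost]

lemma div_le_sensitivity (C : Finset E) (B : WeightedSet E) (a : E) {x : X}
    (hx : B.cost cost x ≠ 0) :
    ((cost a x / B.cost cost x : ℝ≥0) : ℝ≥0∞) ≤ sensitivity cost C B a :=
  le_iSup₂ (f := fun (x : X) (_ : B.cost cost x ≠ 0) =>
    ((cost a x / B.cost cost x : ℝ≥0) : ℝ≥0∞)) x hx

lemma mem_of_sampleMass_ne_zero {q : E → ℝ≥0} {B : Finset E} (hB : B ⊆ A)
    (h : sampleMass A q B ≠ 0) {a : E} (ha : a ∈ A) (hqa : q a = 1) : a ∈ B := by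
  classical
  by_contra hcon
  refine h ?_
  rw [sampleMass_eq_prod hB]
  exact Finset.prod_eq_zero ha (by simp [hcon, hqa])

lemma isCoreset_of_cost_eq_zero {ε : ℝ} (h : ∀ x, (WeightedSet.ofFinset A).cost cost x = 0)
    {B : WeightedSet E} (hB : B.pts ⊆ A) : IsCoreset cost ε B A := by
  refine ⟨hB, fun x => ?_⟩
  have h0 := h x
  have hBx : B.cost cost x = 0 := by
    rw [cost_ofFinset] at h0
    refine Finset.sum_eq_zero fun b hb => ?_
    rw [Finset.sum_eq_zero_iff.1 h0 b (hB hb), mul_zero]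
  simp [h0, hBx]

/-- A sample that deviates little on all superlevel sets of the cost is a coreset. -/
lemma isCoreset_of_deviation_le {γ : ℝ≥0} {u : E → ℝ≥0} {ε : ℝ} (hγ : 0 < γ) (hε : 0 < ε)
    (hu : ∀ a ∈ A, sensitivity cost A (WeightedSet.ofFinset A) a ≤ (u a : ℝ≥0∞))
    {B : Finset E} (hB : B ⊆ A) (hmass : sampleMass A (samplingRate γ u) B ≠ 0)
    (hdev : ∀ R ∈ superlevelFamily cost A (fun a => (samplingRate γ u a)⁻¹),
      |deviation (samplingRate γ u) R B| ≤
        ε / 2 * (∑ a ∈ R, (samplingRate γ u a : ℝ) + γ)) :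
    IsCoreset cost ε ⟨B, fun a => (samplingRate γ u a)⁻¹⟩ A := by
  classical
  refine ⟨hB, fun x => ?_⟩
  set q := samplingRate γ u with hq
  set K := (WeightedSet.ofFinset A).cost cost x with hK
  have hKsum : K = ∑ a ∈ A, cost a x := cost_ofFinset cost A x
  rcases eq_or_ne K 0 with h0 | h0
  · have hBx : (WeightedSet.mk B fun a => (q a)⁻¹).cost cost x = 0 := by
      rw [hKsum] at h0
      refine Finset.sum_eq_zero fun b hb => ?_
      rw [Finset.sum_eq_zero_iff.1 h0 b (hB hb), mul_zero]
    simp [h0, hBx]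
  have hKpos : (0 : ℝ) < K := by exact_mod_cast pos_iff_ne_zero.2 h0
  have hγpos : (0 : ℝ) < γ := hγ
  set f : E → ℝ := fun a => cost a x / K with hf
  have hf0 : ∀ a, 0 ≤ f a := fun a => by positivity
  have hfu : ∀ a ∈ A, f a ≤ u a := by
    intro a ha
    have h1 := (div_le_sensitivity (cost := cost) A (WeightedSet.ofFinset A) a h0).trans (hu a ha)
    have h2 : cost a x / K ≤ u a := by exact_mod_cast h1
    exact_mod_cast h2
  have hfsum : ∑ a ∈ A, f a = 1 := by
    rw [hf, ← Finset.sum_div, hKsum]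
    push_cast
    rw [div_self]
    have := hKpos.ne'
    rw [hKsum] at this
    exact_mod_cast this
  set g : E → ℝ := fun a => (q a : ℝ)⁻¹ * f a with hg
  have hg0 : ∀ a, 0 ≤ g a := fun a => mul_nonneg (by positivity) (hf0 a)
  have hqg : ∀ a ∈ A, (q a : ℝ) * g a = f a := by
    intro a ha
    -- A rate `0` forces `u a = 0` and so `f a = 0`; the convention `0⁻¹ = 0` is then harmless.
    rcases eq_or_ne (q a) 0 with hqa | hqa
    · have hua : u a = 0 := by
        rw [hq, samplingRate] at hqa
        rcases min_choice 1 (γ * u a) with h | h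
        · rw [h] at hqa; exact absurd hqa one_ne_zero
        · rw [h] at hqa
          exact (mul_eq_zero.1 hqa).resolve_left hγ.ne'
      have := hfu a ha
      rw [hua] at this
      have hfa : f a = 0 := le_antisymm this (hf0 a)
      simp [hqa, hfa]
    · have : (q a : ℝ) ≠ 0 := by exact_mod_cast hqa
      rw [hg]
      field_simp
  set z : E → ℝ := fun a => (if a ∈ B then 1 else 0) - (q a : ℝ) with hz
  -- Truncation at `1 / γ` is free: either `q a = 1`, where `z a = 0` because the outcome has
  -- nonzero mass, or `q a = γ * u a`, where `g a ≤ 1 / γ`.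
  have hzmin : ∀ a ∈ A, z a * min (g a) (1 / γ) = z a * g a := by
    intro a ha
    rcases min_choice 1 (γ * u a) with h | h
    · have hqa : q a = 1 := h
      have : z a = 0 := by simp [hz, mem_of_sampleMass_ne_zero hB hmass ha hqa, hqa]
      simp [this]
    · have hqa : (q a : ℝ) = γ * u a := by
        have : q a = γ * u a := h
        rw [this]; push_cast; rfl
      rw [min_eq_left]
      rcases eq_or_ne (u a) 0 with hua | hua
      · rw [hg]; simp only [hqa, hua]; simp
      · have hua' : (0 : ℝ) < u a := by exact_mod_cast pos_iff_ne_zero.2 hua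
        rw [hg]
        simp only [hqa]
        rw [inv_mul_eq_div, div_le_div_iff₀ (by positivity) hγpos]
        nlinarith [hfu a ha]
  have hlevel : ∀ t, 0 ≤ t → |∑ a ∈ A.filter (fun a => t < g a), z a| ≤
      ε / 2 * (∑ a ∈ A.filter (fun a => t < g a), (q a : ℝ) + γ) := by
    intro t ht
    lift t to ℝ≥0 using ht
    refine hdev _ (Finset.mem_filter.2 ⟨Finset.mem_powerset.2 (Finset.filter_subset _ _), x,
      t * K, ?_⟩)
    refine Finset.filter_congr fun a _ => ?_
    rw [← NNReal.coe_lt_coe, NNReal.coe_mul, NNReal.coe_mul, NNReal.coe_inv, hg, hf]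
    beta_reduce
    rw [← mul_div_assoc, lt_div_iff₀ hKpos]
  have hM : (0 : ℝ) ≤ 1 / γ := by positivity
  have hqmin : ∑ a ∈ A, (q a : ℝ) * min (g a) (1 / γ) ≤ 1 := by
    rw [← hfsum]
    refine Finset.sum_le_sum fun a ha => ?_
    rw [← hqg a ha]
    exact mul_le_mul_of_nonneg_left (min_le_left _ _) (q a).2
  -- Moving the relative part of the bound into `z` leaves the constant `ε / 2 * γ`. It integrates
  -- to `ε / 2` over `[0, 1 / γ)`, and by `hqmin` the relative part costs another `ε / 2`.
  have hup := sum_mul_min_le (z := fun a => z a - ε / 2 * q a) (κ := ε / 2 * γ) hM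
    (fun a _ => hg0 a) (s := A) (fun t ht => by
      rw [Finset.sum_sub_distrib, ← Finset.mul_sum]
      linarith [le_of_abs_le (hlevel t ht)])
  have hlo := sum_mul_min_le (z := fun a => -z a - ε / 2 * q a) (κ := ε / 2 * γ) hM
    (fun a _ => hg0 a) (s := A) (fun t ht => by
      rw [Finset.sum_sub_distrib, ← Finset.mul_sum, Finset.sum_neg_distrib]
      linarith [neg_le_of_abs_le (hlevel t ht)])
  have hzg : ∑ a ∈ A, z a * min (g a) (1 / γ) =
      ((WeightedSet.mk B fun a => (q a)⁻¹).cost cost x : ℝ) / K - 1 := by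
    rw [Finset.sum_congr rfl hzmin]
    have e1 : ∑ a ∈ A, z a * g a = ∑ a ∈ A, (if a ∈ B then g a else 0) - ∑ a ∈ A, f a := by
      rw [← Finset.sum_sub_distrib]
      refine Finset.sum_congr rfl fun a ha => ?_
      rw [← hqg a ha]
      by_cases hb : a ∈ B <;> simp [hz, hb, sub_mul]
    rw [e1, hfsum, Finset.sum_ite_mem, Finset.inter_eq_right.2 hB]
    congr 1
    rw [WeightedSet.cost]
    push_cast
    rw [Finset.sum_div]
    refine Finset.sum_congr rfl fun a _ => ?_
    rw [hg, hf]
    simp only [mul_div_assoc]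
  have e2 : ε / 2 * γ * (1 / γ) = ε / 2 := by field_simp
  rw [e2] at hup hlo
  simp only [sub_mul, neg_mul, Finset.sum_sub_distrib, Finset.sum_neg_distrib, hzg, mul_assoc,
    ← Finset.mul_sum] at hup hlo
  have h3 := mul_le_mul_of_nonneg_left hqmin (show 0 ≤ ε / 2 by positivity)
  have h4 : ((WeightedSet.mk B fun a => (q a)⁻¹).cost cost x : ℝ) / K ≤ 1 + ε := by linarith
  have h5 : 1 - ε ≤ ((WeightedSet.mk B fun a => (q a)⁻¹).cost cost x : ℝ) / K := by linarith
  rw [div_le_iff₀ hKpos] at h4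
  rw [le_div_iff₀ hKpos] at h5
  exact ⟨h5, h4⟩

lemma importance_sampling {γ : ℝ≥0} {u : E → ℝ≥0} {ε δ : ℝ}
    (hu : ∀ a ∈ A, sensitivity cost A (WeightedSet.ofFinset A) a ≤ (u a : ℝ≥0∞))
    (hε0 : 0 < ε) (hε1 : ε < 1) (hδ0 : 0 < δ) (hδ1 : δ < 1)
    (hγ : oversampling 67108864 ε δ A.card (∑ a ∈ A, (u a : ℝ))
      (systemDim cost A (fun a => (samplingRate γ u a)⁻¹)) ≤ γ) :
    1 - δ ≤ sampleProb A (samplingRate γ u) (fun B =>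
      IsCoreset cost ε ⟨B, fun a => (samplingRate γ u a)⁻¹⟩ A ∧
      (B.card : ℝ) ≤ 2 * (γ : ℝ) * max 1 (∑ a ∈ A, (u a : ℝ))) := by
  classical
  set q := samplingRate γ u with hqdef
  set w : E → ℝ≥0 := fun a => (q a)⁻¹ with hw
  set D := systemDim cost A w with hD
  set U := ∑ a ∈ A, (u a : ℝ) with hU
  have hq : ∀ a ∈ A, q a ≤ 1 := fun a _ => samplingRate_le_one γ u a
  -- The truncated total lies below both `n` and `‖u‖₁`, which produces the minimum in the
  -- logarithm. As `γ ≥ 1`, also `q a ≤ γ * min (1, u a)`.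
  set V := ∑ a ∈ A, (min 1 (u a) : ℝ) with hV
  have hV0 : 0 ≤ V := Finset.sum_nonneg fun a _ => le_min zero_le_one (u a).2
  have hVU : V ≤ U := Finset.sum_le_sum fun a _ => min_le_right _ _
  have hVn : V ≤ A.card := by
    have : V ≤ ∑ a ∈ A, (1 : ℝ) := Finset.sum_le_sum fun a _ => min_le_left _ _
    simpa using this
  have hlog2 := Real.log_two_gt_d9
  have hLlog : Real.log 2 ≤ Real.log (2 / δ) := Real.log_le_log (by norm_num)
    (by rw [le_div_iff₀ hδ0]; linarith)
  have hDV : 0 ≤ D * V := by positivity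
  have hG0 : 0 ≤ D * Real.log (2 + D * V) := mul_nonneg (by positivity)
    (Real.log_nonneg (by linarith))
  have hεγ : 67108864 * (D * Real.log (2 + D * V) + Real.log (2 / δ)) ≤ ε ^ 2 * γ := by
    have h1 : (D : ℝ) * Real.log (2 + D * V) ≤ D * Real.log (2 + D * min (A.card : ℝ) U) := by
      refine mul_le_mul_of_nonneg_left (Real.log_le_log (by linarith) ?_) (by positivity)
      have := mul_le_mul_of_nonneg_left (le_min hVn hVU) (show (0 : ℝ) ≤ D by positivity)
      linarith
    rw [oversampling, div_mul_eq_mul_div, div_le_iff₀ (by positivity)] at hγ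
    linarith
  have hε2 : ε ^ 2 ≤ 1 := pow_le_one₀ hε0.le hε1.le
  have hγε : ε ^ 2 * γ ≤ γ := mul_le_of_le_one_left γ.2 hε2
  have hγL : 67108864 * Real.log (2 / δ) ≤ γ := by linarith
  have hγ1 : (1 : ℝ) ≤ γ := by linarith
  have hγpos : 0 < γ := by exact_mod_cast zero_lt_one.trans_le hγ1
  have hsumV : ∑ a ∈ A, (q a : ℝ) ≤ γ * V := by
    rw [hV, Finset.mul_sum]
    refine Finset.sum_le_sum fun a _ => ?_
    rw [hqdef, samplingRate]
    push_cast
    rcases le_total (1 : ℝ) (u a) with h | h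
    · rw [min_eq_left h]
      exact (min_le_left _ _).trans (by linarith)
    · rw [min_eq_right h]
      exact min_le_right _ _
  have hexp : ∀ m : ℝ, γ ≤ m → Real.exp (-(m / 4)) ≤ δ / 2 := by
    intro m hm
    have e : δ / 2 = Real.exp (-Real.log (2 / δ)) := by
      rw [Real.exp_neg, Real.exp_log (by positivity), inv_div]
    rw [e]
    exact Real.exp_le_exp.2 (by linarith)
  by_cases hx : ∃ x, (WeightedSet.ofFinset A).cost cost x ≠ 0
  · obtain ⟨x, hx⟩ := hx
    -- The shares `cost a x / cost (A, x)` sum to `1` and each is at most `min (1, u a)`. This gives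
    -- `γ ≤ γ * V`, needed for the deviation bound.
    have hV1 : 1 ≤ V := by
      have h1 : ∑ a ∈ A, cost a x / (WeightedSet.ofFinset A).cost cost x = 1 := by
        rw [← Finset.sum_div, ← cost_ofFinset, div_self hx]
      have h2 : (1 : ℝ) = ∑ a ∈ A,
          ((cost a x / (WeightedSet.ofFinset A).cost cost x : ℝ≥0) : ℝ) := by
        rw [← NNReal.coe_sum, h1, NNReal.coe_one]
      rw [h2]
      refine Finset.sum_le_sum fun a ha => le_min ?_ ?_
      · have : cost a x / (WeightedSet.ofFinset A).cost cost x ≤ 1 := by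
          rw [← h1]
          exact Finset.single_le_sum
            (f := fun a => cost a x / (WeightedSet.ofFinset A).cost cost x)
            (fun _ _ => zero_le) ha
        exact_mod_cast this
      · have h3 := (div_le_sensitivity (cost := cost) A _ a hx).trans (hu a ha)
        exact_mod_cast h3
    have hm : (γ : ℝ) ≤ γ * V := le_mul_of_one_le_right γ.2 hV1
    -- The factor `2` is affordable since `2 * 18874368 ≤ 67108864`.
    have hlogV : D * Real.log (2 + D * (4 * (γ * V) / γ)) ≤ 2 * (D * Real.log (2 + D * V)) := by
      have e : 4 * ((γ : ℝ) * V) / γ = 4 * V := by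
        have : (γ : ℝ) ≠ 0 := by exact_mod_cast hγpos.ne'
        field_simp
      have h1 : Real.log (2 + D * (4 * V)) ≤ 2 * Real.log (2 + D * V) := by
        have : 2 * Real.log (2 + D * V) = Real.log ((2 + D * V) ^ 2) := by
          rw [Real.log_pow]; norm_num
        rw [this]
        exact Real.log_le_log (by linarith) (by nlinarith)
      rw [e]
      linarith [mul_le_mul_of_nonneg_left h1 (show (0 : ℝ) ≤ D by positivity)]
    have h1 := sampleProb_exists_deviation_gt_le (F := superlevelFamily cost A w) (ε := ε) (δ := δ)
      (m := γ * V) (γ := γ) hq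
      (fun R hR => Finset.mem_powerset.1 (Finset.mem_filter.1 hR).1)
      (hasTraceBound_superlevelFamily cost A w) hsumV (by linarith) hm hε0 hε1 hδ0 hδ1
      (by linarith)
    have h2 := (sampleProb_card_gt_le hq hsumV).trans (hexp _ hm)
    have h3 := sampleProb_or_le hq (fun B => 2 * (γ * V) < (B.card : ℝ))
      (fun B => (B.card : ℝ) ≤ 2 * (γ * V) ∧ ∃ R ∈ superlevelFamily cost A w,
        ε / 2 * (∑ a ∈ R, (q a : ℝ) + γ) < |deviation q R B|)
    have h4 := sampleProb_add_not A q (fun B => 2 * (γ * V) < (B.card : ℝ) ∨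
      ((B.card : ℝ) ≤ 2 * (γ * V) ∧ ∃ R ∈ superlevelFamily cost A w,
        ε / 2 * (∑ a ∈ R, (q a : ℝ) + γ) < |deviation q R B|))
    have h5 : 1 - δ ≤ sampleProb A q (fun B => ¬ (2 * (γ * V) < (B.card : ℝ) ∨
      ((B.card : ℝ) ≤ 2 * (γ * V) ∧ ∃ R ∈ superlevelFamily cost A w,
        ε / 2 * (∑ a ∈ R, (q a : ℝ) + γ) < |deviation q R B|))) := by linarith
    refine h5.trans (sampleProb_mono hq fun B hB hmass h => ?_)
    push Not at h
    refine ⟨isCoreset_of_deviation_le hγpos hε0 hu hB hmass (h.2 h.1), h.1.trans ?_⟩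
    rw [mul_assoc]
    have : (γ : ℝ) * V ≤ γ * max 1 U :=
      mul_le_mul_of_nonneg_left (hVU.trans (le_max_right _ _)) γ.2
    linarith
  -- All costs vanish, so every subset is a coreset and only the size matters; `V` may be below `1`,
  -- hence the `max 1`.
  · push Not at hx
    have hm : (γ : ℝ) ≤ γ * max 1 U := le_mul_of_one_le_right γ.2 (le_max_left _ _)
    have h1 : ∑ a ∈ A, (q a : ℝ) ≤ γ * max 1 U :=
      hsumV.trans (mul_le_mul_of_nonneg_left (hVU.trans (le_max_right _ _)) γ.2)
    have h2 := (sampleProb_card_gt_le hq h1).trans (hexp _ hm)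
    have h3 := sampleProb_add_not A q (fun B => 2 * (γ * max 1 U) < (B.card : ℝ))
    have h4 : 1 - δ ≤ sampleProb A q (fun B => ¬ 2 * (γ * max 1 U) < (B.card : ℝ)) := by linarith
    refine h4.trans (sampleProb_mono hq fun B hB _ h => ⟨isCoreset_of_cost_eq_zero hx hB, ?_⟩)
    rw [mul_assoc]
    exact not_lt.1 h

end ImportanceSampling

/-! ### Monotonicity of sensitivities and their stability under coresets. -/

section Sensitivity

variable {E X : Type*} {cost : E → X → ℝ≥0}

/-- Shrinking the set shrinks the denominator. An `x` that drops out of the supremum has `cost (S,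
x) = 0`, hence `cost a x = 0` as `a ∈ S`; this is why the uniform overestimate adjoins `a` to `A'`.
-/
lemma sensitivity_anti {A S : Finset E} (C C' : Finset E) (hSA : S ⊆ A) {a : E} (ha : a ∈ S) :
    sensitivity cost C (WeightedSet.ofFinset A) a ≤
      sensitivity cost C' (WeightedSet.ofFinset S) a := by
  refine iSup₂_le fun x _ => ?_
  rcases eq_or_ne ((WeightedSet.ofFinset S).cost cost x) 0 with h0 | h0
  · have : cost a x = 0 := by
      rw [cost_ofFinset] at h0
      exact Finset.sum_eq_zero_iff.1 h0 a ha
    simp [this]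
  · refine le_trans ?_ (div_le_sensitivity C' _ a h0)
    rw [ENNReal.coe_le_coe]
    refine div_le_div_of_nonneg_left zero_le (pos_iff_ne_zero.2 h0) ?_
    rw [cost_ofFinset, cost_ofFinset]
    exact Finset.sum_le_sum_of_subset hSA

lemma sensitivity_le_uniformOverestimate {A A' : Finset E} (hA' : A' ⊆ A) {a : E} (ha : a ∈ A) :
    sensitivity cost A (WeightedSet.ofFinset A) a ≤
      uniformOverestimate (sensitivity cost) A A' a := by
  classical
  unfold uniformOverestimate
  split_ifs with h
  · exact sensitivity_anti A A hA' h
  · exact sensitivity_anti A A (Finset.insert_subset ha hA') (by simp)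

/-- Since `ε < 1`, the costs of `A` and `B` vanish at the same `x`, so both suprema run over the
same set and the ratios compare pointwise. -/
lemma IsCoreset.sensitivity_bounds {ε : ℝ} (hε0 : 0 < ε) (hε1 : ε < 1) {A : Finset E}
    {B : WeightedSet E} (h : IsCoreset cost ε B A) (C : Finset E) (c : E) :
    ENNReal.ofReal (1 / (1 + ε)) * sensitivity cost C (WeightedSet.ofFinset A) c ≤
      sensitivity cost C B c ∧
    sensitivity cost C B c ≤
      ENNReal.ofReal (1 / (1 - ε)) * sensitivity cost C (WeightedSet.ofFinset A) c := by
  have hε : 0 < 1 - ε := by linarith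
  have hpos : ∀ {r : ℝ≥0}, r ≠ 0 → (0 : ℝ) < r := fun h => by
    exact_mod_cast pos_iff_ne_zero.2 h
  have hconv : ∀ r : ℝ≥0, (r : ℝ≥0∞) = ENNReal.ofReal r := fun r => by simp
  constructor
  · rw [sensitivity, ENNReal.mul_iSup]
    refine iSup_le fun x => ?_
    rw [ENNReal.mul_iSup]
    refine iSup_le fun hx => ?_
    obtain ⟨h1, h2⟩ := h.2 x
    have hA := hpos hx
    have hB : (0 : ℝ) < B.cost cost x := (mul_pos hε hA).trans_le h1
    refine le_trans ?_ (div_le_sensitivity C B c (x := x) (by exact_mod_cast hB.ne'))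
    rw [hconv, hconv, ← ENNReal.ofReal_mul (by positivity)]
    refine ENNReal.ofReal_le_ofReal ?_
    push_cast
    rw [div_mul_div_comm, one_mul]
    exact div_le_div_of_nonneg_left (by positivity) hB h2
  · refine iSup₂_le fun x hx => ?_
    obtain ⟨h1, h2⟩ := h.2 x
    have hB := hpos hx
    have hA : (0 : ℝ) < (WeightedSet.ofFinset A).cost cost x :=
      pos_of_mul_pos_right (hB.trans_le h2) (by linarith)
    refine le_trans ?_ (mul_le_mul_right (div_le_sensitivity C (WeightedSet.ofFinset A) c
      (x := x) (by exact_mod_cast hA.ne')) _)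
    rw [hconv, hconv, ← ENNReal.ofReal_mul (by positivity)]
    refine ENNReal.ofReal_le_ofReal ?_
    push_cast
    rw [div_mul_div_comm, one_mul]
    exact div_le_div_of_nonneg_left (by positivity) (mul_pos hε hA) h1

end Sensitivity

theorem mainTheorem2 :
    ∃ c : ℝ, 0 < c ∧
      ∀ (d : ℕ) (X : Type*) (cost : EuclideanSpace ℝ (Fin d) → X → ℝ≥0) (sumS : ℝ≥0),
        (∀ C : Finset (EuclideanSpace ℝ (Fin d)),
          ∑ a ∈ C, sensitivity cost C (WeightedSet.ofFinset C) a ≤ (sumS : ℝ≥0∞)) →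
        SamplingConditions cost (sensitivity cost) sumS (oversampling c) := by
  refine ⟨67108864, by norm_num, fun d X cost sumS hsum => ?_⟩
  refine ⟨fun A S _ => hsum S, fun A A' hA' a ha => sensitivity_le_uniformOverestimate hA' ha,
    fun A u hu ε δ hε0 hε1 hδ0 hδ1 γ hγ => ⟨?_, importance_sampling hu hε0 hε1 hδ0 hδ1 hγ⟩,
    fun ε hε0 hε1 A B h C c _ => h.sensitivity_bounds hε0 hε1 C c⟩
  rw [expectedSize_eq, Finset.mul_sum]
  refine Finset.sum_le_sum fun a _ => ?_
  exact_mod_cast min_le_right (1 : ℝ≥0) (γ * u a)
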